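/- **Theorem 6.3.** Let $k$ be a field of characteristic $\neq 2$, let $n\ge 1$, and let $B_n$ (resp. $C_n$) be the quiver whose underlying graph is a chain of $n$ vertices $1 - 2 - \cdots - n$ with an arbitrary orientation of the edges, where the last vertex $n$ has the sign $\sigma(n)=+1$ (resp. $\sigma(n)=-1$) and all other vertices and all arrows are unsigned (have sign $0$). Let $\widetilde Q$ be the associated symmetric quiver: one adds a vertex $i^*$ for each unsigned vertex $i$ and an arrow $\varphi^*: q^*\to p^*$ for each arrow $\varphi:p\to q$ (with $n^*=n$, $i^{**}=i$, $\varphi^{**}=\varphi$); new vertices are unsigned. The dual $V^*$ of a finite-dimensional representation $V$ of $\widetilde Q$ over $k$ is given by $V^*(i)=V(i^*)^*$ and $V^*(\varphi)=s_\varphi V(\varphi^*)^*$, where $s_\varphi=-1$ if the head of $\varphi$ has sign $-1$, and $s_\varphi=1$ otherwise. A representation $V$ is *symmetric* if there are isomorphisms $J_i:V(i)\to V(i^*)^*$ with $J_{i^*}=(J_i)^*$ for $i\ne i^*$ and $(J_n)^*=\sigma(n)J_n$, which form an isomorphism of representations $V\to V^*$. A nonzero symmetric representation is *indecomposable symmetric*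 if it is not isomorphic to a direct sum of two nonzero symmetric representations. Let $D\subset \mathbb Z_{\ge 0}^{\widetilde Q_0}$ be the set of dimension vectors of the indecomposable symmetric representations of $\widetilde Q$. Then $D\cup(-D)$ is a finite, reduced, crystallographic root system in the $\mathbb Q$-span of $D$, of type $B_n$ (resp. $C_n$), and $D$ is its set of positive roots with respect to the base $\beta_1,\dots,\beta_n$, where $\beta_i=\varepsilon_i+\varepsilon_{i^*}$ for $i<n$ and $\beta_n=\varepsilon_n$ (resp. $\beta_n=2\varepsilon_n$), $\varepsilon_i$ being the standard basis vectors. Explicitly, the Cartan matrix $(\langle\beta_i,\beta_j^\vee\rangle)_{i,j}$ of this base is the standard one of type $B_n$, with $\beta_n$ the short simple root (resp. of type $C_n$, with $\beta_n$ the long simple root; for $n=1$ both are the matrix $(2)$). -/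

import Mathlib

universe u

noncomputable section

/-- A signed quiver: a finite quiver with vertices `V` and arrows `E`, an involution `twin` of the
vertices whose two-element orbits are the pairs of twins, and signs in `{-1, 0, 1}` on vertices and
arrows. A vertex or an arrow is called signed if its sign is nonzero. -/
structure SignedQuiver where
  V : Type
  E : Type
  finite_V : Finite V
  finite_E : Finite E
  tail : E → V
  head : E → V
  twin : V → V
  twin_twin : ∀ i, twin (twin i) = i
  vsign : V → SignType
  esign : E → SignType
  /-- twins are unsigned -/
  vsign_eq_zero : ∀ i, twin i ≠ i → vsign i = 0
  /-- a non-loop arrow is signed if and only if its end vertices are twins -/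
  esign_ne_zero_iff : ∀ a, tail a ≠ head a → (esign a ≠ 0 ↔ twin (tail a) = head a)
  /-- a loop is signed if and only if its vertex is signed -/
  esign_loop_ne_zero_iff : ∀ a, tail a = head a → (esign a ≠ 0 ↔ vsign (tail a) ≠ 0)

namespace SignedQuiver

variable (Q : SignedQuiver)

/-- A vertex that is unsigned and is not one of a pair of twins. -/
def IsSingleUnsigned (i : Q.V) : Prop := Q.twin i = i ∧ Q.vsign i = 0

/-- The vertices of the symmetric quiver `Q̃`: the vertices `of i` of `Q`, together with a new vertex
`i*` for each single unsigned vertex `i` of `Q`. -/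
inductive Double : Type
  | of (i : Q.V) : Double
  | new (i : Q.V) (h : Q.IsSingleUnsigned i) : Double

/-- The arrows of `Q̃`: those of `Q`, together with a new arrow `φ*` for each unsigned arrow `φ`. -/
inductive DoubleArrow : Type
  | of (a : Q.E) : DoubleArrow
  | new (a : Q.E) (h : Q.esign a = 0) : DoubleArrow

variable {Q}

namespace Double

open Classical in
/-- The involution on the vertices of `Q̃`. -/
def star : Q.Double → Q.Double
  | of i => if h : Q.IsSingleUnsigned i then new i h else of (Q.twin i)
  | new i _ => of i

/-- The signs of the vertices of `Q̃`; the new vertices are unsigned. -/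
def sign : Q.Double → SignType
  | of i => Q.vsign i
  | new _ _ => 0

theorem star_star (i : Q.Double) : i.star.star = i := by
  cases i with
  | of i =>
    by_cases h : Q.IsSingleUnsigned i
    · simp [star, h]
    · have h' : ¬ Q.IsSingleUnsigned (Q.twin i) := by
        rintro ⟨h1, h2⟩
        rw [Q.twin_twin] at h1
        rw [← h1] at h2
        exact h ⟨h1.symm, h2⟩
      simp [star, h, h', Q.twin_twin]
  | new i h => simp [star, h]

/-- Along a signed arrow the involution of the vertices interchanges tail and head. -/
theorem star_of_tail {a : Q.E} (h : Q.esign a ≠ 0) : (of (Q.tail a)).star = of (Q.head a) := by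
  by_cases hl : Q.tail a = Q.head a
  · have h1 := (Q.esign_loop_ne_zero_iff a hl).1 h
    have h2 : Q.twin (Q.tail a) = Q.tail a := by
      by_contra hne
      exact h1 (Q.vsign_eq_zero _ hne)
    have h3 : ¬ Q.IsSingleUnsigned (Q.tail a) := fun hs => h1 hs.2
    simp only [star, h3, dite_false]
    rw [h2, hl]
  · have h1 := (Q.esign_ne_zero_iff a hl).1 h
    have h3 : ¬ Q.IsSingleUnsigned (Q.tail a) := fun hs => hl (hs.1.symm.trans h1)
    simp only [star, h3, dite_false]
    rw [h1]

end Double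

namespace DoubleArrow

/-- The tail of an arrow of `Q̃`; for `φ : p → q` unsigned, `φ*` goes from `q*` to `p*`. -/
def tail : Q.DoubleArrow → Q.Double
  | of a => Double.of (Q.tail a)
  | new a _ => (Double.of (Q.head a)).star

/-- The head of an arrow of `Q̃`. -/
def head : Q.DoubleArrow → Q.Double
  | of a => Double.of (Q.head a)
  | new a _ => (Double.of (Q.tail a)).star

open Classical in
/-- The involution on the arrows of `Q̃`; it fixes the signed arrows. -/
def star : Q.DoubleArrow → Q.DoubleArrow
  | of a => if h : Q.esign a = 0 then new a h else of a
  | new a _ => of a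

/-- The signs of the arrows of `Q̃`; the new arrows are unsigned. -/
def sign : Q.DoubleArrow → SignType
  | of a => Q.esign a
  | new _ _ => 0

theorem tail_star (a : Q.DoubleArrow) : a.star.tail = a.head.star := by
  cases a with
  | of a =>
    by_cases h : Q.esign a = 0
    · simp [star, tail, head, h]
    · simp only [star, h, dite_false, tail, head]
      rw [← Double.star_of_tail h, Double.star_star]
  | new a h => simp [star, tail, head, Double.star_star]

theorem head_star (a : Q.DoubleArrow) : a.star.head = a.tail.star := by
  cases a with
  | of a =>
    by_cases h : Q.esign a = 0
    · simp [star, tail, head, h]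
    · simp only [star, h, dite_false, tail, head]
      rw [← Double.star_of_tail h]
  | new a h => simp [star, tail, head, Double.star_star]

end DoubleArrow

/-- The quiver `Q̃`. -/
instance : Quiver Q.Double where
  Hom i j := {a : Q.DoubleArrow // a.tail = i ∧ a.head = j}

/-- The involution of `Q̃` on arrows: `φ : i → j` goes to `φ* : j* → i*`. -/
def starHom {i j : Q.Double} (φ : i ⟶ j) : j.star ⟶ i.star :=
  ⟨φ.1.star, by rw [DoubleArrow.tail_star, φ.2.2], by rw [DoubleArrow.head_star, φ.2.1]⟩

open Classical in
/-- The sign `s_φ` in the definition of the dual representation: it is `-1` if exactly one of the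
arrow `φ` and its head has sign `-1`, and it is `1` otherwise. -/
def dualSign {i j : Q.Double} (φ : i ⟶ j) : ℤ :=
  if (φ.1.sign = -1 ∧ j.sign ≠ -1) ∨ (φ.1.sign ≠ -1 ∧ j.sign = -1) then -1 else 1

end SignedQuiver

/-- Finite-dimensional representations over `k` of a quiver with vertex set `X`. -/
structure QuiverRep (k : Type u) [Field k] (X : Type) [Quiver.{0, 0} X] where
  obj : X → Type u
  [addCommGroup : ∀ i, AddCommGroup (obj i)]
  [module : ∀ i, Module k (obj i)]
  [finite : ∀ i, Module.Finite k (obj i)]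
  map : ∀ {i j : X}, (i ⟶ j) → (obj i →ₗ[k] obj j)

namespace QuiverRep

attribute [instance] QuiverRep.addCommGroup QuiverRep.module QuiverRep.finite

variable {k : Type u} [Field k] {X : Type} [Quiver.{0, 0} X]

/-- The collection `H` of linear maps is a homomorphism from `U` to `W`. -/
def IsHom (U W : QuiverRep k X) (H : ∀ i, U.obj i →ₗ[k] W.obj i) : Prop :=
  ∀ (i j : X) (φ : i ⟶ j), W.map φ ∘ₗ H i = H j ∘ₗ U.map φ

/-- `U` and `W` are isomorphic as representations of the quiver. -/
def Isomorphic (U W : QuiverRep k X) : Prop :=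
  ∃ H : ∀ i, U.obj i ≃ₗ[k] W.obj i, IsHom U W fun i => (H i : U.obj i →ₗ[k] W.obj i)

/-- The direct sum of two representations. -/
def directSum (U W : QuiverRep k X) : QuiverRep k X where
  obj i := U.obj i × W.obj i
  map φ := (U.map φ).prodMap (W.map φ)

/-- The zero representation (up to isomorphism). -/
def IsZero (U : QuiverRep k X) : Prop := ∀ i, Subsingleton (U.obj i)

variable {Q : SignedQuiver}

/-- The dual of a representation of `Q̃`: `V*(i) = (V(i*))*` and `V*(φ) = s_φ V(φ*)*`. -/
def dual (V : QuiverRep k Q.Double) : QuiverRep k Q.Double where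
  obj i := Module.Dual k (V.obj i.star)
  map φ := SignedQuiver.dualSign φ • (V.map (SignedQuiver.starHom φ)).dualMap

/-- A signed form on the spaces `V(i)`: isomorphisms `J_i : V(i) → V(i*)*` with `J_{i*} = (J_i)*` if
`i ≠ i*`, and `(J_i)* = σ(i) J_i` if `i = i*`. The second vertex argument `j` of `form` is `i*`. -/
structure SignedForm (V : QuiverRep k Q.Double) where
  form : ∀ i j : Q.Double, i.star = j → (V.obj i ≃ₗ[k] Module.Dual k (V.obj j))
  form_of_ne : ∀ (i j : Q.Double) (h : i.star = j) (h' : j.star = i), i ≠ j →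
    ∀ (x : V.obj i) (y : V.obj j), form j i h' y x = form i j h x y
  form_of_fixed : ∀ (i : Q.Double) (h : i.star = i) (x y : V.obj i),
    form i i h y x = (i.sign : k) * form i i h x y

/-- The isomorphism `J_i : V(i) → V*(i)`. -/
def SignedForm.toDual {V : QuiverRep k Q.Double} (J : SignedForm V) (i : Q.Double) :
    V.obj i →ₗ[k] V.dual.obj i :=
  (J.form i i.star rfl : V.obj i →ₗ[k] Module.Dual k (V.obj i.star))

/-- A representation of `Q̃` is symmetric if for some signed form `J` the maps `J_i` are an
isomorphism from `V` to its dual. -/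
def IsSymmetric (V : QuiverRep k Q.Double) : Prop :=
  ∃ J : SignedForm V, IsHom V V.dual J.toDual

/-- Indecomposable symmetric representations: nonzero symmetric representations that are not
isomorphic to a direct sum of two nonzero symmetric representations. -/
def IsIndecomposableSymmetric (V : QuiverRep k Q.Double) : Prop :=
  V.IsSymmetric ∧ ¬ V.IsZero ∧
    ∀ U W : QuiverRep k Q.Double, U.IsSymmetric → W.IsSymmetric →
      V.Isomorphic (U.directSum W) → U.IsZero ∨ W.IsZero

end QuiverRep

namespace SignedQuiver

/-- The dimension vectors, in the space `ℚ^(Q̃₀)`, of the indecomposable symmetric representations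
of `Q̃` over `k`. -/
def symDims (k : Type u) [Field k] (Q : SignedQuiver) : Set (Q.Double → ℚ) :=
  {d | ∃ V : QuiverRep k Q.Double, V.IsIndecomposableSymmetric ∧
    ∀ i, d i = (Module.finrank k (V.obj i) : ℚ)}

open Classical in
/-- The vector `β_i` attached to the orbit of a vertex `i`: `ε_i`, `2 ε_i` or `ε_i + ε_{i*}` according
as the sign of `i` is `1`, `-1` or `0`. -/
def simpleVector (Q : SignedQuiver) (i : Q.V) : Q.Double → ℚ :=
  if Q.vsign i = 1 then Pi.single (Double.of i) 1
  else if Q.vsign i = -1 then Pi.single (Double.of i) 2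
  else Pi.single (Double.of i) 1 + Pi.single (Double.of i).star 1

/-- The signed quiver whose underlying graph is the chain `0 — 1 — ⋯ — n-1` without twins, in
which the last vertex has sign `s` and all other vertices and all arrows are unsigned. The arrow
between `a` and `a + 1` goes from `a` to `a + 1` if `o a` is true and from `a + 1` to `a` otherwise. -/
def chain (n : ℕ) (o : Fin (n - 1) → Bool) (s : SignType) : SignedQuiver where
  V := Fin n
  E := Fin (n - 1)
  finite_V := inferInstance
  finite_E := inferInstance
  tail a := if o a then ⟨a, by omega⟩ else ⟨a + 1, by omega⟩
  head a := if o a then ⟨a + 1, by omega⟩ else ⟨a, by omega⟩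
  twin i := i
  twin_twin _ := rfl
  vsign i := if (i : ℕ) + 1 = n then s else 0
  esign _ := 0
  vsign_eq_zero _ h := absurd rfl h
  esign_ne_zero_iff a h := by simpa using h
  esign_loop_ne_zero_iff a h := by
    exfalso
    cases ho : o a <;> simp [ho] at h

/-- The signed quiver `B_n`, with the orientation `o`. -/
def typeB (n : ℕ) (o : Fin (n - 1) → Bool) : SignedQuiver := chain n o 1

/-- The signed quiver `C_n`, with the orientation `o`. -/
def typeC (n : ℕ) (o : Fin (n - 1) → Bool) : SignedQuiver := chain n o (-1)

end SignedQuiver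

/-- `D` is the set of positive roots of a (finite, reduced, crystallographic) root system in the
`ℚ`-span of `D` with all roots `D ∪ -D`, with respect to the base `β`, whose Cartan matrix
`(⟨β_i, β_j^∨⟩)` is `A`. -/
def IsPositiveRootsOfType {X : Type} {n : ℕ} (D : Set (X → ℚ)) (A : Matrix (Fin n) (Fin n) ℤ)
    (β : Fin n → X → ℚ) : Prop :=
  ∃ (ι : Type) (_ : Finite ι)
    (P : RootPairing ι ℚ (Submodule.span ℚ D) (Module.Dual ℚ (Submodule.span ℚ D)))
    (_ : P.IsRootSystem) (_ : P.IsCrystallographic) (_ : P.IsReduced)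
    (b : P.Base) (e : Fin n ≃ b.support),
    (Set.range fun i => (P.root i : X → ℚ)) = D ∪ {d | -d ∈ D} ∧
    (fun i => (P.root i : X → ℚ)) '' {i | b.IsPos i} = D ∧
    (∀ i, (P.root (e i) : X → ℚ) = β i) ∧
    ∀ i j, b.cartanMatrix (e i) (e j) = A i j

end

/-! A nonzero symmetric representation `V` of a symmetric quiver of type `A` has a direct summand
that is thin, with support an interval `S`. Together with its image under `J` this summand generates
a subrepresentation on which the form is nondegenerate, and which therefore splits off orthogonally.
If `S` is its own mirror image and the form on the middle vertex is symmetric, the summand can be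
chosen such that it is nondegenerate itself (if `v` generates it and `w` its image, then one of `v`,
`w` and `v + w` has nonzero norm, as `2` is invertible); otherwise the subrepresentation is the
hyperbolic sum of the thin representation and its dual. So the indecomposable symmetric
representations correspond to the intervals up to reflection. Sending `e_a` to the indicator of the
symmetric interval that starts at `a` identifies their dimension vectors with the vectors
`e_a ± e_b` for `a < b` and `t e_a`, where `t = 1` for type `B` and `t = 2` for type `C`. -/

/-! ### Thin summands -/

namespace QuiverRep

variable {k : Type u} [Field k] {X : Type} [Quiver.{0, 0} X]

theorem finrank_directSum (A B : QuiverRep k X) (i : X) :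
    Module.finrank k ((A.directSum B).obj i) =
      Module.finrank k (A.obj i) + Module.finrank k (B.obj i) :=
  Module.finrank_prod

theorem Isomorphic.symm {U W : QuiverRep k X} (h : U.Isomorphic W) : W.Isomorphic U := by
  obtain ⟨H, hH⟩ := h
  refine ⟨fun i => (H i).symm, fun i j φ => LinearMap.ext fun x => (H j).injective ?_⟩
  have hcomm := LinearMap.congr_fun (hH i j φ) ((H i).symm x)
  simp only [LinearMap.comp_apply, LinearEquiv.coe_coe, LinearEquiv.apply_symm_apply] at hcomm ⊢
  exact hcomm.symm

theorem Isomorphic.finrank_eq {U W : QuiverRep k X} (h : U.Isomorphic W) (i : X) :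
    Module.finrank k (U.obj i) = Module.finrank k (W.obj i) :=
  (h.choose i).finrank_eq

/-- A family of subspaces which is a subrepresentation of `V`. -/
def IsSubrep (V : QuiverRep k X) (N : ∀ i, Submodule k (V.obj i)) : Prop :=
  ∀ (i j : X) (φ : i ⟶ j), ∀ x ∈ N i, V.map φ x ∈ N j

/-- The representation carried by a subrepresentation of `V`. -/
@[reducible]
def sub (V : QuiverRep k X) (N : ∀ i, Submodule k (V.obj i)) (hN : V.IsSubrep N) :
    QuiverRep k X where
  obj i := N i
  map {i j} φ := (V.map φ).restrict (hN i j φ)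

theorem isomorphic_directSum_sub (V : QuiverRep k X) {N N' : ∀ i, Submodule k (V.obj i)}
    (hN : V.IsSubrep N) (hN' : V.IsSubrep N') (h : ∀ i, IsCompl (N i) (N' i)) :
    V.Isomorphic ((V.sub N hN).directSum (V.sub N' hN')) := by
  refine Isomorphic.symm ⟨fun i => Submodule.prodEquivOfIsCompl (N i) (N' i) (h i), ?_⟩
  rintro i j φ
  exact LinearMap.ext fun ⟨a, b⟩ => map_add (V.map φ) (a : V.obj i) b

/-- The full subquiver on `S` is nonempty and connected: no proper nonempty part of `S` is a union
of connected components. -/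
def ConnectedOn (S : Set X) : Prop :=
  S.Nonempty ∧ ∀ T ⊆ S, T.Nonempty →
    (∀ (i j : X), (i ⟶ j) → i ∈ S → j ∈ S → (i ∈ T ↔ j ∈ T)) → T = S

theorem ConnectedOn.eq_of_edges {S : Set X} (hS : ConnectedOn S) {α : Type*} (θ : X → α)
    (h : ∀ (i j : X), (i ⟶ j) → i ∈ S → j ∈ S → θ i = θ j) {i j : X} (hi : i ∈ S) (hj : j ∈ S) :
    θ i = θ j := by
  have hT : {x | x ∈ S ∧ θ i = θ x} = S := hS.2 _ (fun x hx => hx.1) ⟨i, hi, rfl⟩ (by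
    intro a b φ ha hb
    simp [ha, hb, h a b φ ha hb])
  exact (hT.ge hj).2

/-- A direct summand of `V` that is thin with support `S`, that is, of dimension one at the vertices
of `S` and zero elsewhere, given by a spanning vector and a projection at each vertex. An arrow `φ`
inside `S` acts by the nonzero scalar `scal φ`; outside `S` the value of `scal` is irrelevant. -/
structure ThinSummand (V : QuiverRep k X) (S : Set X) where
  vec : ∀ i, V.obj i
  fn : ∀ i, Module.Dual k (V.obj i)
  scal : ∀ {i j : X}, (i ⟶ j) → k
  scal_ne_zero : ∀ {i j : X} (φ : i ⟶ j), scal φ ≠ 0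
  vec_eq_zero : ∀ i, i ∉ S → vec i = 0
  fn_eq_zero : ∀ i, i ∉ S → fn i = 0
  fn_vec : ∀ i, i ∈ S → fn i (vec i) = 1
  map_vec : ∀ {i j : X} (φ : i ⟶ j), i ∈ S → V.map φ (vec i) = scal φ • vec j
  fn_map : ∀ {i j : X} (φ : i ⟶ j), j ∈ S → ∀ x, fn j (V.map φ x) = scal φ * fn i x

namespace ThinSummand

variable {V A B : QuiverRep k X} {S S' : Set X}

theorem vec_ne_zero (t : ThinSummand V S) {i : X} (hi : i ∈ S) : t.vec i ≠ 0 := fun h => by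
  have := t.fn_vec i hi
  simp [h] at this

/-- The thin summand is all of `V`. -/
def Spans (t : ThinSummand V S) : Prop := ∀ i x, x = t.fn i x • t.vec i

/-- All arrows act by the scalar one in the chosen basis of the thin summand. -/
def IsNormalized (t : ThinSummand V S) : Prop :=
  ∀ (i j : X) (φ : i ⟶ j), t.scal φ = 1

/-- Transport of a thin summand along an isomorphism. -/
def ofIso (t : ThinSummand A S) (H : ∀ i, V.obj i ≃ₗ[k] A.obj i)
    (hH : IsHom V A fun i => (H i : V.obj i →ₗ[k] A.obj i)) : ThinSummand V S where
  vec i := (H i).symm (t.vec i)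
  fn i := t.fn i ∘ₗ (H i : V.obj i →ₗ[k] A.obj i)
  scal := t.scal
  scal_ne_zero := t.scal_ne_zero
  vec_eq_zero i hi := by rw [t.vec_eq_zero i hi, map_zero]
  fn_eq_zero i hi := by rw [t.fn_eq_zero i hi, LinearMap.zero_comp]
  fn_vec i hi := by simp [t.fn_vec i hi]
  map_vec {i j} φ hi := (H j).injective <| by
    have hcomm := LinearMap.congr_fun (hH i j φ) ((H i).symm (t.vec i))
    simp only [LinearMap.comp_apply, LinearEquiv.coe_coe, LinearEquiv.apply_symm_apply] at hcomm
    rw [← hcomm, t.map_vec φ hi, map_smul, LinearEquiv.apply_symm_apply]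
  fn_map {i j} φ hj x := by
    have hcomm := LinearMap.congr_fun (hH i j φ) x
    simp only [LinearMap.comp_apply, LinearEquiv.coe_coe] at hcomm ⊢
    rw [← hcomm, t.fn_map φ hj]

/-- A thin summand of `A`, as a thin summand of `A ⊕ B`. -/
def inl (t : ThinSummand A S) (B : QuiverRep k X) : ThinSummand (A.directSum B) S where
  vec i := (t.vec i, 0)
  fn i := t.fn i ∘ₗ LinearMap.fst k (A.obj i) (B.obj i)
  scal := t.scal
  scal_ne_zero := t.scal_ne_zero
  vec_eq_zero i hi := Prod.ext (t.vec_eq_zero i hi) rfl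
  fn_eq_zero i hi := LinearMap.ext fun x => LinearMap.congr_fun (t.fn_eq_zero i hi) x.1
  fn_vec i hi := t.fn_vec i hi
  map_vec φ hi := Prod.ext (t.map_vec φ hi) ((map_zero (B.map φ)).trans (smul_zero _).symm)
  fn_map φ hj x := t.fn_map φ hj x.1

/-- A thin summand of `B`, as a thin summand of `A ⊕ B`. -/
def inr (t : ThinSummand B S) (A : QuiverRep k X) : ThinSummand (A.directSum B) S where
  vec i := (0, t.vec i)
  fn i := t.fn i ∘ₗ LinearMap.snd k (A.obj i) (B.obj i)
  scal := t.scal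
  scal_ne_zero := t.scal_ne_zero
  vec_eq_zero i hi := Prod.ext rfl (t.vec_eq_zero i hi)
  fn_eq_zero i hi := LinearMap.ext fun x => LinearMap.congr_fun (t.fn_eq_zero i hi) x.2
  fn_vec i hi := t.fn_vec i hi
  map_vec φ hi := Prod.ext ((map_zero (A.map φ)).trans (smul_zero _).symm) (t.map_vec φ hi)
  fn_map φ hj x := t.fn_map φ hj x.2

/-- The composite `t → V → t' → V → t` of inclusions and projections of two thin summands, a scalar
at each vertex. -/
def pairing (t : ThinSummand V S) (t' : ThinSummand V S') (i : X) : k :=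
  t'.fn i (t.vec i) * t.fn i (t'.vec i)

theorem pairing_comm (t : ThinSummand V S) (t' : ThinSummand V S') (i : X) :
    t.pairing t' i = t'.pairing t i := mul_comm _ _

theorem pairing_eq_zero_of_notMem (t : ThinSummand V S) (t' : ThinSummand V S') {i : X}
    (hi : i ∉ S) : t.pairing t' i = 0 := by
  simp [pairing, t.vec_eq_zero i hi]

theorem scal_mul_fn_vec (t : ThinSummand V S) (t' : ThinSummand V S') {i j : X} (φ : i ⟶ j)
    (hi : i ∈ S) (hj : j ∈ S') :
    t.scal φ * t'.fn j (t.vec j) = t'.scal φ * t'.fn i (t.vec i) := by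
  rw [← t'.fn_map φ hj, t.map_vec φ hi, map_smul, smul_eq_mul]

theorem pairing_eq_of_hom (t : ThinSummand V S) (t' : ThinSummand V S') {i j : X} (φ : i ⟶ j)
    (hi : i ∈ S) (hj : j ∈ S) : t.pairing t' i = t.pairing t' j := by
  have hφ := t.scal_ne_zero φ
  unfold pairing
  by_cases hi' : i ∈ S' <;> by_cases hj' : j ∈ S'
  · have e := scal_mul_fn_vec t t' φ hi hj'
    have e' := scal_mul_fn_vec t' t φ hi' hj
    apply mul_left_cancel₀ (mul_ne_zero hφ (t'.scal_ne_zero φ))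
    linear_combination (-t'.scal φ * t.fn j (t'.vec j)) * e
      - (t'.scal φ * t'.fn i (t.vec i)) * e'
  · have e' := scal_mul_fn_vec t' t φ hi' hj
    rw [t'.vec_eq_zero j hj'] at e' ⊢
    simp only [map_zero, mul_zero] at e' ⊢
    simp [(mul_eq_zero.1 e'.symm).resolve_left hφ]
  · have e := scal_mul_fn_vec t t' φ hi hj'
    rw [t'.fn_eq_zero i hi'] at e ⊢
    simp only [LinearMap.zero_apply, mul_zero, zero_mul] at e ⊢
    simp [(mul_eq_zero.1 e).resolve_left hφ]
  · simp [t'.vec_eq_zero j hj', t'.vec_eq_zero i hi']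

theorem pairing_eq (t : ThinSummand V S) (t' : ThinSummand V S') (hS : ConnectedOn S) {i j : X}
    (hi : i ∈ S) (hj : j ∈ S) : t.pairing t' i = t.pairing t' j :=
  hS.eq_of_edges _ (fun _ _ φ => t.pairing_eq_of_hom t' φ) hi hj

theorem subset_of_pairing_ne_zero (t : ThinSummand V S) (t' : ThinSummand V S')
    (hS : ConnectedOn S) {i : X} (h : t.pairing t' i ≠ 0) : S ⊆ S' := by
  have hi : i ∈ S := not_imp_comm.1 (t.pairing_eq_zero_of_notMem t') h
  intro j hj
  rw [t.pairing_eq t' hS hi hj, pairing_comm] at h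
  exact not_imp_comm.1 (t'.pairing_eq_zero_of_notMem t) h

theorem eq_of_pairing_ne_zero (t : ThinSummand V S) (t' : ThinSummand V S') (hS : ConnectedOn S)
    (hS' : ConnectedOn S') {i : X} (h : t.pairing t' i ≠ 0) : S = S' :=
  (t.subset_of_pairing_ne_zero t' hS h).antisymm
    (t'.subset_of_pairing_ne_zero t hS' (by rwa [pairing_comm]))

theorem eq_or_eq_of_directSum {S₁ S₂ : Set X} (t : ThinSummand (A.directSum B) S)
    {t₁ : ThinSummand A S₁} (ht₁ : t₁.Spans) {t₂ : ThinSummand B S₂} (ht₂ : t₂.Spans)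
    (hS : ConnectedOn S) (hS₁ : ConnectedOn S₁) (hS₂ : ConnectedOn S₂) : S = S₁ ∨ S = S₂ := by
  obtain ⟨i, hi⟩ := hS.1
  have hvec : t.vec i = (t₁.inl B).fn i (t.vec i) • (t₁.inl B).vec i +
      (t₂.inr A).fn i (t.vec i) • (t₂.inr A).vec i := by
    refine Prod.ext ((ht₁ i _).trans ?_) ((ht₂ i _).trans ?_)
    · exact (add_eq_left.2 (smul_zero (t₂.fn i (t.vec i).2))).symm
    · exact (add_eq_right.2 (smul_zero (t₁.fn i (t.vec i).1))).symm
  have hsum : t.pairing (t₁.inl B) i + t.pairing (t₂.inr A) i = 1 := by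
    have := congrArg (t.fn i) hvec
    rw [t.fn_vec i hi, map_add, map_smul, map_smul] at this
    exact this.symm
  by_cases h0 : t.pairing (t₁.inl B) i = 0
  · refine Or.inr (t.eq_of_pairing_ne_zero (t₂.inr A) hS hS₂ (i := i) ?_)
    rw [h0, zero_add] at hsum
    exact hsum ▸ one_ne_zero
  · exact Or.inl (t.eq_of_pairing_ne_zero (t₁.inl B) hS hS₁ h0)

theorem nonempty_of_isomorphic (t : ThinSummand A S) (h : V.Isomorphic A) :
    Nonempty (ThinSummand V S) :=
  let ⟨H, hH⟩ := h
  ⟨t.ofIso H hH⟩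

end ThinSummand

end QuiverRep

/-! ### Symmetric representations -/

namespace SignedQuiver

variable {Q : SignedQuiver}

theorem Double.sign_eq_zero_of_star_ne {i : Q.Double} (h : i.star ≠ i) : i.sign = 0 := by
  cases i with
  | of i =>
    by_contra hs
    have hi : ¬ Q.IsSingleUnsigned i := fun hi => hs hi.2
    simp only [Double.star, hi, dite_false, ne_eq, Double.of.injEq] at h
    exact hs (Q.vsign_eq_zero i h)
  | new i hi => rfl

theorem Double.sign_ne_zero_of_star_eq {i : Q.Double} (h : i.star = i) : i.sign ≠ 0 := by
  cases i with
  | of i =>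
    intro hs
    by_cases hi : Q.IsSingleUnsigned i
    · simp [Double.star, hi] at h
    · simp only [Double.star, hi, dite_false, Double.of.injEq] at h
      exact hi ⟨h, hs⟩
  | new i hi => simp [Double.star] at h

theorem Double.sign_star (i : Q.Double) : i.star.sign = i.sign := by
  by_cases h : i.star = i
  · rw [h]
  · rw [Double.sign_eq_zero_of_star_ne h, Double.sign_eq_zero_of_star_ne]
    rwa [Double.star_star, ne_comm]

theorem DoubleArrow.star_star (a : Q.DoubleArrow) : a.star.star = a := by
  cases a with
  | of a => by_cases h : Q.esign a = 0 <;> simp [DoubleArrow.star, h]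
  | new a h => simp [DoubleArrow.star, h]

theorem DoubleArrow.sign_star (a : Q.DoubleArrow) : a.star.sign = a.sign := by
  cases a with
  | of a => by_cases h : Q.esign a = 0 <;> simp [DoubleArrow.star, DoubleArrow.sign, h]
  | new a h => exact h

open Classical in
/-- The sign `ε_i` by which signed forms between `V(i)` and `V(i*)` change if their arguments are
exchanged. -/
def vertexSign (i : Q.Double) : ℤ := if i.sign = -1 then -1 else 1

theorem vertexSign_mul_self (i : Q.Double) : vertexSign i * vertexSign i = 1 := by
  unfold vertexSign
  split_ifs <;> rfl

theorem vertexSign_cast_ne_zero {k : Type u} [Field k] (i : Q.Double) :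
    (vertexSign i : k) ≠ 0 := by
  unfold vertexSign
  split_ifs <;> simp

theorem vertexSign_star (i : Q.Double) : vertexSign i.star = vertexSign i := by
  simp only [vertexSign, Double.sign_star]

theorem dualSign_cast_ne_zero {k : Type u} [Field k] {i j : Q.Double} (φ : i ⟶ j) :
    (dualSign φ : k) ≠ 0 := by
  unfold dualSign
  split_ifs <;> simp

theorem dualSign_mul_starHom {i j : Q.Double} (φ : i ⟶ j) :
    dualSign φ * dualSign (starHom φ) = vertexSign i * vertexSign j := by
  have hφ : (starHom φ).1.sign = φ.1.sign := DoubleArrow.sign_star φ.1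
  simp only [dualSign, vertexSign, hφ, Double.sign_star]
  by_cases h₁ : φ.1.sign = -1 <;> by_cases h₂ : j.sign = -1 <;> by_cases h₃ : i.sign = -1 <;>
    simp [h₁, h₂, h₃]

theorem vertexSign_eq {i : Q.Double} (h : i.star = i) : vertexSign i = (i.sign : ℤ) := by
  have h0 := Double.sign_ne_zero_of_star_eq h
  unfold vertexSign
  generalize i.sign = s at h0
  cases s <;> simp_all

theorem vertexSign_eq_one {i : Q.Double} (h : i.star ≠ i) : vertexSign i = 1 := by
  simp [vertexSign, Double.sign_eq_zero_of_star_ne h]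

end SignedQuiver

namespace QuiverRep

open SignedQuiver

variable {k : Type u} [Field k]

section Form

variable {Q : SignedQuiver} {V : QuiverRep k Q.Double}

namespace SignedForm

variable (J : SignedForm V)

theorem form_swap {i j : Q.Double} (h : i.star = j) (h' : j.star = i) (x : V.obj i)
    (y : V.obj j) : J.form j i h' y x = (vertexSign i : k) * J.form i j h x y := by
  by_cases hij : i = j
  · subst hij
    rw [J.form_of_fixed i h, vertexSign_eq h]
    norm_cast
  · rw [J.form_of_ne i j h h' hij, vertexSign_eq_one (by rwa [h, ne_comm]), Int.cast_one, one_mul]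

theorem form_map (hJ : IsHom V V.dual J.toDual) {i j : Q.Double} (φ : i ⟶ j) (x : V.obj i)
    (y : V.obj j.star) :
    J.form j j.star rfl (V.map φ x) y =
      (dualSign φ : k) * J.form i i.star rfl x (V.map (starHom φ) y) := by
  have hcomm : dualSign φ • J.form i i.star rfl x (V.map (starHom φ) y) =
      J.form j j.star rfl (V.map φ x) y :=
    LinearMap.congr_fun
      (LinearMap.congr_fun (hJ i j φ) x : (_ : Module.Dual k (V.obj j.star)) = _) y
  rw [← hcomm, zsmul_eq_mul]

/-- The form is nondegenerate on the family `N` of subspaces. -/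
def NondegenerateOn (N : ∀ i, Submodule k (V.obj i)) : Prop :=
  ∀ (i j : Q.Double) (h : i.star = j), ∀ x ∈ N i, (∀ y ∈ N j, J.form i j h x y = 0) → x = 0

/-- The orthogonal complements of a family of subspaces. -/
def perp (N : ∀ i, Submodule k (V.obj i)) (i : Q.Double) : Submodule k (V.obj i) where
  carrier := {x | ∀ y ∈ N i.star, J.form i i.star rfl x y = 0}
  add_mem' ha hb y hy := by simp [ha y hy, hb y hy]
  zero_mem' y _ := by simp
  smul_mem' c x hx y hy := by simp [hx y hy]

theorem mem_perp {N : ∀ i, Submodule k (V.obj i)} {i j : Q.Double} (h : i.star = j)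
    {x : V.obj i} : x ∈ J.perp N i ↔ ∀ y ∈ N j, J.form i j h x y = 0 := by
  subst h
  rfl

/-- The form restricted to a family of subspaces. -/
def restrict (N : ∀ i, Submodule k (V.obj i)) (i j : Q.Double) (h : i.star = j) :
    N i →ₗ[k] Module.Dual k (N j) :=
  (N j).subtype.dualMap ∘ₗ (J.form i j h : V.obj i →ₗ[k] _) ∘ₗ (N i).subtype

variable {J} {N : ∀ i, Submodule k (V.obj i)}

theorem NondegenerateOn.restrict_injective (hN : J.NondegenerateOn N) (i j : Q.Double)
    (h : i.star = j) : Function.Injective (J.restrict N i j h) := by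
  rw [← LinearMap.ker_eq_bot, LinearMap.ker_eq_bot']
  exact fun x hx => Subtype.ext <|
    hN i j h x x.2 fun y hy => LinearMap.congr_fun hx (⟨y, hy⟩ : N j)

theorem NondegenerateOn.finrank_eq (hN : J.NondegenerateOn N) (i j : Q.Double)
    (h : i.star = j) : Module.finrank k (N i) = Module.finrank k (Module.Dual k (N j)) := by
  have hle : ∀ i j, i.star = j → Module.finrank k (N i) ≤ Module.finrank k (N j) := by
    intro i j h
    rw [← Subspace.dual_finrank_eq (V := N j)]
    exact LinearMap.finrank_le_finrank_of_injective (hN.restrict_injective i j h)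
  rw [Subspace.dual_finrank_eq]
  exact le_antisymm (hle i j h) (hle j i (by rw [← h, Double.star_star]))

theorem NondegenerateOn.isSymmetric_sub (hJ : IsHom V V.dual J.toDual) (hN : J.NondegenerateOn N)
    (hs : V.IsSubrep N) : (V.sub N hs).IsSymmetric := by
  refine ⟨⟨fun i j h => LinearMap.linearEquivOfInjective (J.restrict N i j h)
    (hN.restrict_injective i j h) (hN.finrank_eq i j h), ?_, ?_⟩, ?_⟩
  · exact fun i j h h' hij x y => J.form_of_ne i j h h' hij x.1 y.1
  · exact fun i h x y => J.form_of_fixed i h x.1 y.1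
  · refine fun i j φ => LinearMap.ext fun x => LinearMap.ext fun y => ?_
    have hmap := J.form_map hJ φ x.1 y.1
    rw [← zsmul_eq_mul] at hmap
    exact hmap.symm

theorem isSubrep_perp (hJ : IsHom V V.dual J.toDual) (hs : V.IsSubrep N) :
    V.IsSubrep (J.perp N) := by
  intro i j φ x hx y hy
  rw [J.form_map hJ, hx _ (hs _ _ (starHom φ) y hy), mul_zero]

theorem NondegenerateOn.isCompl_perp (hN : J.NondegenerateOn N) (i : Q.Double) :
    IsCompl (N i) (J.perp N i) := by
  refine IsCompl.of_eq ?_ ?_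
  · rw [Submodule.eq_bot_iff]
    rintro x ⟨hx, hx'⟩
    exact hN i i.star rfl x hx hx'
  · rw [Submodule.eq_top_iff']
    intro x
    have hsurj := (LinearMap.injective_iff_surjective_of_finrank_eq_finrank
      (hN.finrank_eq i i.star rfl)).1 (hN.restrict_injective i i.star rfl)
    obtain ⟨z, hz⟩ := hsurj ((N i.star).subtype.dualMap (J.form i i.star rfl x))
    rw [← add_sub_cancel (z : V.obj i) x]
    refine Submodule.add_mem_sup z.2 fun y hy => ?_
    have hzy : J.form i i.star rfl (z : V.obj i) y = J.form i i.star rfl x y :=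
      LinearMap.congr_fun hz ⟨y, hy⟩
    rw [map_sub, LinearMap.sub_apply, hzy, sub_self]

theorem NondegenerateOn.perp (hN : J.NondegenerateOn N) : J.NondegenerateOn (J.perp N) := by
  refine fun i j h x hx hx' => (J.form i j h).map_eq_zero_iff.1 (LinearMap.ext fun y => ?_)
  obtain ⟨a, ha, b, hb, rfl⟩ := Submodule.mem_sup.1
    ((hN.isCompl_perp j).sup_eq_top ▸ Submodule.mem_top : y ∈ N j ⊔ J.perp N j)
  rw [map_add, (J.mem_perp h).1 hx a ha, hx' b hb, add_zero, LinearMap.zero_apply]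

end SignedForm

theorem IsIndecomposableSymmetric.eq_top (hV : V.IsIndecomposableSymmetric)
    {J : SignedForm V} (hJ : IsHom V V.dual J.toDual) {N : ∀ i, Submodule k (V.obj i)}
    (hs : V.IsSubrep N) (hN : J.NondegenerateOn N) {i₀ : Q.Double} (h0 : N i₀ ≠ ⊥) (i : Q.Double) :
    N i = ⊤ := by
  have hs' := SignedForm.isSubrep_perp hJ hs
  rcases hV.2.2 _ _ (hN.isSymmetric_sub hJ hs) (hN.perp.isSymmetric_sub hJ hs')
    (V.isomorphic_directSum_sub hs hs' hN.isCompl_perp) with h | h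
  · exact absurd (Submodule.subsingleton_iff_eq_bot.1 (h i₀)) h0
  · have hsup := (hN.isCompl_perp i).sup_eq_top
    rwa [Submodule.subsingleton_iff_eq_bot.1 (h i), sup_bot_eq] at hsup

theorem map_cast {X : Type} [Quiver.{0, 0} X] (W : QuiverRep k X) {i j i' j' : X} (hi : i = i')
    (hj : j = j') (φ : i ⟶ j) (φ' : i' ⟶ j') (h : φ ≍ φ') (x : W.obj i) :
    W.map φ' (LinearEquiv.cast (R := k) (M := W.obj) hi x) =
      LinearEquiv.cast (R := k) (M := W.obj) hj (W.map φ x) := by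
  subst hi hj h
  rfl

theorem starHom_starHom {i j : Q.Double} (φ : i ⟶ j) : φ ≍ starHom (starHom φ) := by
  refine (Subtype.heq_iff_coe_eq ?_).2 (DoubleArrow.star_star φ.1).symm
  simp only [Double.star_star, implies_true]

/-- The equivalence `W(i) ⊕ W(i*)^* ≃ (W(i*) ⊕ W(i)^*)^*` sending `(x, f)` to the functional
`(y, g) ↦ f(y) + ε_i g(x)`. -/
noncomputable def hyperbolicEquiv (W : QuiverRep k Q.Double) (i j : Q.Double) (h : i.star = j) :
    (W.obj i × Module.Dual k (W.obj i.star)) ≃ₗ[k]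
      Module.Dual k (W.obj j × Module.Dual k (W.obj j.star)) :=
  LinearEquiv.prodComm k _ _ ≪≫ₗ
    (LinearEquiv.cast (R := k) (M := W.obj) h.symm).dualMap.prodCongr
      (LinearEquiv.cast (R := k) (M := W.obj) (by rw [← h, Double.star_star]) ≪≫ₗ
        LinearEquiv.smulOfNeZero k _ (vertexSign i : k) (vertexSign_cast_ne_zero i) ≪≫ₗ
        Module.evalEquiv k (W.obj j.star)) ≪≫ₗ
    Module.dualProdDualEquivDual k _ _

theorem hyperbolicEquiv_apply (W : QuiverRep k Q.Double) {i j : Q.Double} (h : i.star = j)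
    (x : W.obj i) (f : Module.Dual k (W.obj i.star)) (y : W.obj j)
    (g : Module.Dual k (W.obj j.star)) :
    W.hyperbolicEquiv i j h (x, f) (y, g) =
      f (LinearEquiv.cast (R := k) (M := W.obj) h.symm y) + (vertexSign i : k) *
        g (LinearEquiv.cast (R := k) (M := W.obj) (by rw [← h, Double.star_star]) x) := by
  simp [hyperbolicEquiv]

theorem hyperbolicEquiv_swap (W : QuiverRep k Q.Double) {i j : Q.Double} (h : i.star = j)
    (h' : j.star = i) (x : W.obj i × Module.Dual k (W.obj i.star))
    (y : W.obj j × Module.Dual k (W.obj j.star)) :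
    W.hyperbolicEquiv j i h' y x = (vertexSign i : k) * W.hyperbolicEquiv i j h x y := by
  have hsign : (vertexSign i : k) * vertexSign i = 1 := by
    simpa using congrArg (Int.cast : ℤ → k) (vertexSign_mul_self i)
  have hj : vertexSign j = vertexSign i := by rw [← h, vertexSign_star]
  obtain ⟨x, f⟩ := x
  obtain ⟨y, g⟩ := y
  rw [hyperbolicEquiv_apply, hyperbolicEquiv_apply, hj]
  linear_combination
    -g (LinearEquiv.cast (R := k) (M := W.obj) (by rw [← h, Double.star_star]) x) * hsign

theorem isSymmetric_hyperbolic (W : QuiverRep k Q.Double) : (W.directSum W.dual).IsSymmetric := by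
  refine ⟨⟨W.hyperbolicEquiv, fun i j h h' hij x y => ?_, fun i h x y => ?_⟩,
    fun i j φ => LinearMap.ext fun x => LinearMap.ext fun y => ?_⟩
  · have := W.hyperbolicEquiv_swap h h' x y
    rwa [vertexSign_eq_one (by rwa [h, ne_comm]), Int.cast_one, one_mul] at this
  · have := W.hyperbolicEquiv_swap h h x y
    rw [vertexSign_eq h] at this
    exact_mod_cast this
  · obtain ⟨x, (f : Module.Dual k (W.obj i.star))⟩ := x
    obtain ⟨(y : W.obj j.star), (g : Module.Dual k (W.obj j.star.star))⟩ := y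
    have hsign : dualSign φ * (vertexSign i * dualSign (starHom φ)) = vertexSign j := by
      linear_combination
        vertexSign i * dualSign_mul_starHom φ + vertexSign j * vertexSign_mul_self i
    have hsign' : (dualSign φ : k) * (vertexSign i * dualSign (starHom φ)) = vertexSign j := by
      exact_mod_cast congrArg (Int.cast : ℤ → k) hsign
    change dualSign φ • W.hyperbolicEquiv i i.star rfl (x, f)
        (W.map (starHom φ) y, dualSign (starHom φ) • (g ∘ₗ W.map (starHom (starHom φ)))) =
      W.hyperbolicEquiv j j.star rfl (W.map φ x, dualSign φ • (f ∘ₗ W.map (starHom φ))) (y, g)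
    simp only [hyperbolicEquiv_apply, LinearMap.smul_apply, LinearMap.comp_apply,
      LinearEquiv.cast_apply, cast_eq, ← hsign', zsmul_eq_mul]
    have := W.map_cast i.star_star.symm j.star_star.symm φ _ (starHom_starHom φ) x
    simp only [LinearEquiv.cast_apply] at this
    rw [this]
    ring

end Form

namespace ThinSummand

section Pair

variable {X : Type} [Quiver.{0, 0} X] {V : QuiverRep k X} {S S' : Set X}

theorem isSubrep_span_pair (t : ThinSummand V S) (t' : ThinSummand V S') :
    V.IsSubrep fun i => Submodule.span k {t.vec i, t'.vec i} := by
  have map_mem {T : Set X} (s : ThinSummand V T) {i j : X} (φ : i ⟶ j) {N : Submodule k (V.obj j)}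
      (hN : s.vec j ∈ N) : V.map φ (s.vec i) ∈ N := by
    by_cases hi : i ∈ T
    · exact s.map_vec φ hi ▸ N.smul_mem _ hN
    · simp [s.vec_eq_zero i hi]
  intro i j φ x hx
  obtain ⟨a, b, rfl⟩ := Submodule.mem_span_pair.1 hx
  rw [map_add, map_smul, map_smul]
  exact add_mem (Submodule.smul_mem _ _ (map_mem t φ (Submodule.subset_span (by simp))))
    (Submodule.smul_mem _ _ (map_mem t' φ (Submodule.subset_span (by simp))))

theorem smul_vec_eq_zero_of_pairing (t : ThinSummand V S) (t' : ThinSummand V S') {i : X}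
    (hp : t.pairing t' i = 0) {a b : k} (h : t.fn i (a • t.vec i + b • t'.vec i) = 0)
    (h' : t'.fn i (a • t.vec i + b • t'.vec i) = 0) : a • t.vec i = 0 := by
  by_cases hi : i ∈ S
  · suffices a = 0 by rw [this, zero_smul]
    simp only [map_add, map_smul, smul_eq_mul, t.fn_vec i hi, mul_one] at h h'
    by_cases hi' : i ∈ S'
    · rw [t'.fn_vec i hi', mul_one] at h'
      rw [pairing] at hp
      linear_combination h - t.fn i (t'.vec i) * h' + a * hp
    · simpa [t'.vec_eq_zero i hi'] using h
  · rw [t.vec_eq_zero i hi, smul_zero]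

theorem eq_zero_of_mem_span_pair (t : ThinSummand V S) (t' : ThinSummand V S') {i : X}
    (hp : t.pairing t' i = 0) {x : V.obj i} (hx : x ∈ Submodule.span k {t.vec i, t'.vec i})
    (h : t.fn i x = 0) (h' : t'.fn i x = 0) : x = 0 := by
  obtain ⟨a, b, rfl⟩ := Submodule.mem_span_pair.1 hx
  have hp' : t'.pairing t i = 0 := by rwa [pairing_comm]
  rw [t.smul_vec_eq_zero_of_pairing t' hp h h',
    t'.smul_vec_eq_zero_of_pairing t hp' (by rwa [add_comm]) (by rwa [add_comm]), add_zero]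

open Classical in
theorem finrank_span_vec (t : ThinSummand V S) (i : X) :
    Module.finrank k (Submodule.span k {t.vec i}) = if i ∈ S then 1 else 0 := by
  split_ifs with hi
  · exact finrank_span_singleton (t.vec_ne_zero hi)
  · rw [t.vec_eq_zero i hi, Submodule.span_zero_singleton, finrank_bot]

open Classical in
theorem finrank_span_pair (t : ThinSummand V S) (t' : ThinSummand V S') {i : X}
    (hp : t.pairing t' i = 0) :
    Module.finrank k (Submodule.span k {t.vec i, t'.vec i}) =
      (if i ∈ S then 1 else 0) + if i ∈ S' then 1 else 0 := by
  have hdisj : Submodule.span k {t.vec i} ⊓ Submodule.span k {t'.vec i} = ⊥ := by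
    refine (Submodule.eq_bot_iff _).2 ?_
    rintro _ ⟨hx, hx'⟩
    obtain ⟨a, rfl⟩ := Submodule.mem_span_singleton.1 hx
    obtain ⟨b, hb⟩ := Submodule.mem_span_singleton.1 hx'
    have h0 : a • t.vec i + (-b) • t'.vec i = 0 := by rw [neg_smul, hb, add_neg_cancel]
    exact t.smul_vec_eq_zero_of_pairing t' hp (by rw [h0, map_zero]) (by rw [h0, map_zero])
  have hsum := Submodule.finrank_sup_add_finrank_inf_eq (Submodule.span k {t.vec i})
    (Submodule.span k {t'.vec i})
  rwa [hdisj, finrank_bot, add_zero, ← Submodule.span_insert, t.finrank_span_vec,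
    t'.finrank_span_vec] at hsum

end Pair

variable {Q : SignedQuiver} {V : QuiverRep k Q.Double} {S : Set Q.Double}

/-- The dual of a thin summand of `V`, as a thin summand of `V*`. -/
noncomputable def dualRep (t : ThinSummand V S) : ThinSummand V.dual (Double.star ⁻¹' S) where
  vec i := t.fn i.star
  fn i := Module.Dual.eval k (V.obj i.star) (t.vec i.star)
  scal φ := (dualSign φ : k) * t.scal (starHom φ)
  scal_ne_zero φ := mul_ne_zero (dualSign_cast_ne_zero φ) (t.scal_ne_zero _)
  vec_eq_zero i hi := t.fn_eq_zero _ hi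
  fn_eq_zero i hi := by rw [t.vec_eq_zero _ hi, map_zero]; rfl
  fn_vec i hi := t.fn_vec _ hi
  map_vec {i j} φ hi := LinearMap.ext fun x => by
    change dualSign φ • t.fn i.star (V.map (starHom φ) x) = _ * t.fn j.star x
    rw [t.fn_map (starHom φ) hi, zsmul_eq_mul, mul_assoc]
  fn_map {i j} φ hj (f : Module.Dual k (V.obj i.star)) := by
    change dualSign φ • f (V.map (starHom φ) (t.vec j.star)) = _ * f (t.vec i.star)
    rw [t.map_vec (starHom φ) hj, map_smul, zsmul_eq_mul, smul_eq_mul, mul_assoc]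

theorem Spans.dualRep {t : ThinSummand V S} (ht : t.Spans) : t.dualRep.Spans := by
  refine fun i (f : Module.Dual k (V.obj i.star)) => LinearMap.ext fun x => ?_
  change f x = f (t.vec i.star) * t.fn i.star x
  conv_lhs => rw [ht i.star x]
  rw [map_smul, smul_eq_mul, mul_comm]

variable (J : SignedForm V) (hJ : IsHom V V.dual J.toDual) (t : ThinSummand V S)

/-- The dual of a thin summand of `V`, as a thin summand of `V ≃ V*`. -/
noncomputable def dual : ThinSummand V (Double.star ⁻¹' S) :=
  t.dualRep.ofIso (fun i => J.form i i.star rfl) hJ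

theorem form_dual_vec {i j : Q.Double} (h : i.star = j) (y : V.obj j) :
    J.form i j h ((t.dual J hJ).vec i) y = t.fn j y := by
  subst h
  exact LinearMap.congr_fun ((J.form i i.star rfl).apply_symm_apply (t.fn i.star)) y

theorem form_vec {i j : Q.Double} (h : i.star = j) (x : V.obj i) :
    J.form i j h x (t.vec j) = (t.dual J hJ).fn i x := by
  subst h
  rfl

variable {J t}

theorem nondegenerateOn_span_dual (hp : ∀ i, t.pairing (t.dual J hJ) i = 0) :
    J.NondegenerateOn fun i => Submodule.span k {t.vec i, (t.dual J hJ).vec i} := by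
  intro i j h x hx hperp
  refine t.eq_zero_of_mem_span_pair (t.dual J hJ) (hp i) hx ?_ ?_
  · have hdual := hperp _ (Submodule.subset_span (Set.mem_insert_of_mem _ rfl))
    have h' : j.star = i := by rw [← h, Double.star_star]
    rw [J.form_swap h' h, t.form_dual_vec J hJ h'] at hdual
    exact (mul_eq_zero.1 hdual).resolve_left (vertexSign_cast_ne_zero j)
  · rw [← t.form_vec J hJ h]
    exact hperp _ (Submodule.subset_span (Set.mem_insert _ _))

end ThinSummand

section ThinFamily

/-- The vectors `v i` generate a thin subrepresentation supported on `S`, all of whose arrows act by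
the scalar one. -/
def IsThinFamily {X : Type} [Quiver.{0, 0} X] (V : QuiverRep k X) (S : Set X)
    (v : ∀ i, V.obj i) : Prop :=
  (∀ i, i ∉ S → v i = 0) ∧ ∀ (i j : X) (φ : i ⟶ j), i ∈ S → V.map φ (v i) = v j

theorem IsThinFamily.add {X : Type} [Quiver.{0, 0} X] {V : QuiverRep k X} {S : Set X}
    {v w : ∀ i, V.obj i} (hv : IsThinFamily V S v) (hw : IsThinFamily V S w) :
    IsThinFamily V S (v + w) :=
  ⟨fun i hi => by simp [hv.1 i hi, hw.1 i hi],
    fun i j φ hi => by simp [hv.2 i j φ hi, hw.2 i j φ hi]⟩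

theorem IsThinFamily.isSubrep_span {X : Type} [Quiver.{0, 0} X] {V : QuiverRep k X} {S : Set X}
    {v : ∀ i, V.obj i} (hv : IsThinFamily V S v) : V.IsSubrep fun i => Submodule.span k {v i} := by
  intro i j φ x hx
  obtain ⟨a, rfl⟩ := Submodule.mem_span_singleton.1 hx
  rw [map_smul]
  by_cases hi : i ∈ S
  · rw [hv.2 i j φ hi]
    exact Submodule.smul_mem _ _ (Submodule.mem_span_singleton_self _)
  · rw [hv.1 i hi, map_zero, smul_zero]
    exact zero_mem _

theorem ThinSummand.IsNormalized.isThinFamily {X : Type} [Quiver.{0, 0} X] {V : QuiverRep k X}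
    {S : Set X} {t : ThinSummand V S} (ht : t.IsNormalized) : IsThinFamily V S t.vec :=
  ⟨t.vec_eq_zero, fun i j φ hi => by rw [t.map_vec φ hi, ht i j φ, one_smul]⟩

variable {Q : SignedQuiver} {V : QuiverRep k Q.Double} {S : Set Q.Double} {J : SignedForm V}

theorem ThinSummand.IsNormalized.dual {t : ThinSummand V S} (ht : t.IsNormalized)
    (hJ : IsHom V V.dual J.toDual) (hd : ∀ {i j : Q.Double} (φ : i ⟶ j), dualSign φ = 1) :
    (t.dual J hJ).IsNormalized := fun i j φ => by
  change (dualSign φ : k) * t.scal (starHom φ) = 1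
  rw [hd, ht, Int.cast_one, one_mul]

variable {v w : ∀ i, V.obj i}

theorem IsThinFamily.form_eq (hv : IsThinFamily V S v) (hw : IsThinFamily V S w)
    (hS : ConnectedOn S) (hsS : Double.star ⁻¹' S = S) (hJ : IsHom V V.dual J.toDual)
    (hd : ∀ {i j : Q.Double} (φ : i ⟶ j), dualSign φ = 1) {i j : Q.Double} (hi : i ∈ S)
    (hj : j ∈ S) :
    J.form i i.star rfl (v i) (w i.star) = J.form j j.star rfl (v j) (w j.star) := by
  refine hS.eq_of_edges (fun i => J.form i i.star rfl (v i) (w i.star)) ?_ hi hj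
  intro i j φ hi hj
  have hj' : j.star ∈ S := hsS.ge hj
  rw [← hv.2 i j φ hi, J.form_map hJ, hd, hw.2 _ _ (starHom φ) hj', Int.cast_one, one_mul]

theorem IsThinFamily.nondegenerateOn_span (hv : IsThinFamily V S v)
    (h0 : ∀ i ∈ S, J.form i i.star rfl (v i) (v i.star) ≠ 0) :
    J.NondegenerateOn fun i => Submodule.span k {v i} := by
  rintro i j rfl x hx hperp
  obtain ⟨a, rfl⟩ := Submodule.mem_span_singleton.1 hx
  by_cases hi : i ∈ S
  · have hva := hperp _ (Submodule.mem_span_singleton_self _)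
    rw [map_smul, LinearMap.smul_apply, smul_eq_mul] at hva
    rw [(mul_eq_zero.1 hva).resolve_right (h0 i hi), zero_smul]
  · rw [hv.1 i hi, smul_zero]

open Classical in
theorem IsThinFamily.finrank_span (hv : IsThinFamily V S v)
    (h0 : ∀ i ∈ S, J.form i i.star rfl (v i) (v i.star) ≠ 0) (i : Q.Double) :
    Module.finrank k (Submodule.span k {v i}) = if i ∈ S then 1 else 0 := by
  split_ifs with hi
  · exact finrank_span_singleton fun h => h0 i hi (by simp [h])
  · rw [hv.1 i hi, Submodule.span_zero_singleton, finrank_bot]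

/-- If `v` generates the thin summand and `w` its dual, then `⟨v, w⟩ = ⟨w, v⟩ = 1`, so that the
norms of `v`, `w` and `v + w` cannot all vanish. -/
theorem exists_isThinFamily (hk : (2 : k) ≠ 0) (hS : ConnectedOn S)
    (hsS : Double.star ⁻¹' S = S) (hJ : IsHom V V.dual J.toDual)
    (hd : ∀ {i j : Q.Double} (φ : i ⟶ j), dualSign φ = 1)
    (hε : ∀ i : Q.Double, vertexSign i = 1) (t : ThinSummand V S) (ht : t.IsNormalized) :
    ∃ v, IsThinFamily V S v ∧ ∀ i ∈ S, J.form i i.star rfl (v i) (v i.star) ≠ 0 := by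
  have hv := ht.isThinFamily
  have hw : IsThinFamily V S (t.dual J hJ).vec :=
    hsS.rec (motive := fun T _ => IsThinFamily V T (t.dual J hJ).vec) (ht.dual hJ hd).isThinFamily
  by_contra! hcon
  obtain ⟨i, hi⟩ := hS.1
  have isotropic : ∀ v, IsThinFamily V S v → J.form i i.star rfl (v i) (v i.star) = 0 := by
    intro v hv
    obtain ⟨j, hj, hnorm⟩ := hcon v hv
    rw [hv.form_eq hv hS hsS hJ hd hi hj, hnorm]
  have hadd := isotropic _ (hv.add hw)
  have hvw : J.form i i.star rfl (t.vec i) ((t.dual J hJ).vec i.star) = 1 := by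
    rw [J.form_swap i.star_star rfl, hε, Int.cast_one, one_mul, t.form_dual_vec, t.fn_vec _ hi]
  have hwv : J.form i i.star rfl ((t.dual J hJ).vec i) (t.vec i.star) = 1 := by
    have hi' : i.star ∈ S := hsS.ge hi
    rw [t.form_dual_vec, t.fn_vec _ hi']
  simp only [Pi.add_apply, map_add, LinearMap.add_apply, isotropic _ hv, isotropic _ hw, hvw,
    hwv] at hadd
  exact hk (by linear_combination hadd)

end ThinFamily

end QuiverRep

/-! ### Thin summands of representations of quivers of type `A` -/

/-- The underlying graph of the quiver `X` is a chain of `m` vertices, which `pos` numbers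
from `0`. -/
structure IsChainQuiver (X : Type) [Quiver.{0, 0} X] (m : ℕ) (pos : X → ℕ) : Prop where
  injective : Function.Injective pos
  lt : ∀ x, pos x < m
  surj : ∀ p < m, ∃ x, pos x = p
  adj : ∀ x y : X, (x ⟶ y) → pos y = pos x + 1 ∨ pos x = pos y + 1
  edge : ∀ x y : X, pos y = pos x + 1 →
    (∃ φ : x ⟶ y, (∀ ψ, ψ = φ) ∧ IsEmpty (y ⟶ x)) ∨ (∃ φ : y ⟶ x, (∀ ψ, ψ = φ) ∧ IsEmpty (x ⟶ y))

/-- The interval `[p, q]` of a chain. -/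
def posInterval {X : Type} (pos : X → ℕ) (p q : ℕ) : Set X := {x | p ≤ pos x ∧ pos x ≤ q}

/-- The family `u` is supported on the interval `[p, q]`, and `R φ (u x) (u y)` holds for the arrows
`φ : x ⟶ y` inside this interval. -/
def IsCompatibleOn {X : Type} [Quiver.{0, 0} X] {M : X → Type*} [∀ x, Zero (M x)]
    (R : ∀ x y : X, (x ⟶ y) → M x → M y → Prop) (pos : X → ℕ) (p q : ℕ) (u : ∀ x, M x) : Prop :=
  (∀ x ∉ posInterval pos p q, u x = 0) ∧ ∀ (x y : X) (φ : x ⟶ y),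
    x ∈ posInterval pos p q → y ∈ posInterval pos p q → R x y φ (u x) (u y)

namespace IsChainQuiver

variable {X : Type} [Quiver.{0, 0} X] {m : ℕ} {pos : X → ℕ} {p q : ℕ}

theorem eq_of_edges_of_le (hX : IsChainQuiver X m pos) {α : Type*} (θ : X → α)
    (h : ∀ x y : X, (x ⟶ y) → x ∈ posInterval pos p q → y ∈ posInterval pos p q → θ x = θ y)
    {x y : X} (hx : x ∈ posInterval pos p q) (hy : y ∈ posInterval pos p q)
    (hxy : pos x ≤ pos y) : θ x = θ y := by
  obtain ⟨d, hd⟩ := Nat.exists_eq_add_of_le hxy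
  induction d generalizing y with
  | zero => rw [hX.injective hd]
  | succ d ih =>
    obtain ⟨z, hz⟩ := hX.surj (pos x + d) (by have := hX.lt y; omega)
    have hz' : z ∈ posInterval pos p q :=
      ⟨by have := hx.1; omega, by have := hy.2; omega⟩
    refine (ih hz' (by omega) hz).trans ?_
    rcases hX.edge z y (by omega) with ⟨φ, -⟩ | ⟨φ, -⟩
    · exact h z y φ hz' hy
    · exact (h y z φ hy hz').symm

theorem eq_of_edges (hX : IsChainQuiver X m pos) {α : Type*} (θ : X → α)
    (h : ∀ x y : X, (x ⟶ y) → x ∈ posInterval pos p q → y ∈ posInterval pos p q → θ x = θ y)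
    {x y : X} (hx : x ∈ posInterval pos p q) (hy : y ∈ posInterval pos p q) : θ x = θ y :=
  (le_total (pos x) (pos y)).elim (hX.eq_of_edges_of_le θ h hx hy)
    fun hyx => (hX.eq_of_edges_of_le θ h hy hx hyx).symm

theorem connectedOn_posInterval (hX : IsChainQuiver X m pos) (hpq : p ≤ q) (hq : q < m) :
    QuiverRep.ConnectedOn (posInterval pos p q) := by
  obtain ⟨x, hx⟩ := hX.surj q hq
  refine ⟨⟨x, hx ▸ hpq, hx.le⟩, fun T hT ⟨a, ha⟩ h => hT.antisymm fun y hy => ?_⟩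
  exact (hX.eq_of_edges (· ∈ T) (fun x y φ hx hy => propext (h x y φ hx hy)) (hT ha) hy).mp ha

variable {M : X → Type*} [∀ x, Zero (M x)] {R : ∀ x y : X, (x ⟶ y) → M x → M y → Prop}

theorem exists_isCompatibleOn_self (hX : IsChainQuiver X m pos) (i : X) (w : M i) :
    ∃ u, IsCompatibleOn R pos (pos i) (pos i) u ∧ u i = w := by
  classical
  refine ⟨Pi.single i w, ⟨fun x hx => Pi.single_eq_of_ne ?_ _, ?_⟩, Pi.single_eq_same _ _⟩
  · rintro rfl
    exact hx ⟨le_rfl, le_rfl⟩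
  · rintro x y φ ⟨hx, hx'⟩ ⟨hy, hy'⟩
    have := hX.adj x y φ
    omega

theorem exists_isCompatibleOn_succ (hX : IsChainQuiver X m pos) {i j : X} (hp : p ≤ pos i)
    (hij : pos j = pos i + 1) {u : ∀ x, M x} (hu : IsCompatibleOn R pos p (pos i) u) (w : M j)
    (h₁ : ∀ φ : i ⟶ j, R i j φ (u i) w) (h₂ : ∀ φ : j ⟶ i, R j i φ w (u i)) :
    ∃ u', IsCompatibleOn R pos p (pos j) u' ∧ u' j = w := by
  classical
  have hmem {x : X} (hxj : x ≠ j) (hx : x ∈ posInterval pos p (pos j)) :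
      x ∈ posInterval pos p (pos i) := by
    have : pos x ≠ pos j := hX.injective.ne hxj
    exact ⟨hx.1, by have := hx.2; omega⟩
  have hne {x y : X} (φ : x ⟶ y) : x ≠ y := by
    rintro rfl
    have := hX.adj x x φ
    omega
  refine ⟨Function.update u j w, ⟨fun x hx => ?_, fun x y φ hx hy => ?_⟩,
    Function.update_self _ _ _⟩
  · have hxj : x ≠ j := by
      rintro rfl
      exact hx ⟨by omega, le_rfl⟩
    rw [Function.update_of_ne hxj]
    exact hu.1 x fun h => hx ⟨h.1, h.2.trans (by omega)⟩
  · have hadj := hX.adj x y φ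
    rcases eq_or_ne x j with rfl | hxj
    · have hy' := (hmem (hne φ).symm hy).2
      obtain rfl : y = i := hX.injective (by omega)
      rw [Function.update_self, Function.update_of_ne (hne φ).symm]
      exact h₂ φ
    · rw [Function.update_of_ne hxj]
      rcases eq_or_ne y j with rfl | hyj
      · have hx' := (hmem hxj hx).2
        obtain rfl : x = i := hX.injective (by omega)
        rw [Function.update_self]
        exact h₁ φ
      · rw [Function.update_of_ne hyj]
        exact hu.2 x y φ (hmem hxj hx) (hmem hyj hy)

end IsChainQuiver

namespace QuiverRep

variable {k : Type u} [Field k] {X : Type} [Quiver.{0, 0} X] {V : QuiverRep k X}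
  {m : ℕ} {pos : X → ℕ} {p : ℕ} {i j : X}

/-- The vector `v` at `i` belongs to a family of vectors on the interval `[p, i]` which is
compatible with the arrows inside it. -/
def VecExtends (V : QuiverRep k X) (pos : X → ℕ) (p : ℕ) (i : X) (v : V.obj i) : Prop :=
  ∃ u, IsCompatibleOn (M := V.obj) (fun _ _ φ a b => V.map φ a = b) pos p (pos i) u ∧ u i = v

/-- The functional `f` at `i` belongs to a family of functionals on the interval `[p, i]` which is
compatible with the arrows inside it. -/
def FnExtends (V : QuiverRep k X) (pos : X → ℕ) (p : ℕ) (i : X)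
    (f : Module.Dual k (V.obj i)) : Prop :=
  ∃ g, IsCompatibleOn (M := fun x => Module.Dual k (V.obj x))
    (fun _ _ φ a b => b ∘ₗ V.map φ = a) pos p (pos i) g ∧ g i = f

theorem exists_thinSummand_of_extends (hX : IsChainQuiver X m pos)
    (hz : ∀ x, pos x < p → Subsingleton (V.obj x)) (hp : p ≤ pos i) {v : V.obj i}
    {f : Module.Dual k (V.obj i)} (hv : VecExtends V pos p i v) (hf : FnExtends V pos p i f)
    (hfv : f v = 1) (h₁ : ∀ j, pos j = pos i + 1 → ∀ φ : i ⟶ j, V.map φ v = 0)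
    (h₂ : ∀ j, pos j = pos i + 1 → ∀ φ : j ⟶ i, f ∘ₗ V.map φ = 0) :
    ∃ t : ThinSummand V (posInterval pos p (pos i)), t.IsNormalized := by
  obtain ⟨u, ⟨hu0, hu⟩, rfl⟩ := hv
  obtain ⟨g, ⟨hg0, hg⟩, rfl⟩ := hf
  have boundary {x y : X} (hx : x ∈ posInterval pos p (pos i))
      (hy : y ∉ posInterval pos p (pos i)) (hadj : pos y = pos x + 1 ∨ pos x = pos y + 1) :
      pos y < p ∨ (x = i ∧ pos y = pos i + 1) := by
    have hxi := hx.2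
    refine or_iff_not_imp_left.2 fun hyp => ?_
    have : pos i < pos y := not_le.1 fun hle => hy ⟨not_lt.1 hyp, hle⟩
    exact ⟨hX.injective (by omega), by omega⟩
  refine ⟨⟨u, g, fun _ => 1, fun _ => one_ne_zero, hu0, hg0, fun x hx => ?_,
    fun {x y} φ hx => ?_, fun {x y} φ hy v => ?_⟩, fun _ _ _ => rfl⟩
  · rw [← hfv]
    refine hX.eq_of_edges (fun x => g x (u x)) (fun x y φ hx hy => ?_) hx ⟨hp, le_rfl⟩
    rw [← hu x y φ hx hy, ← hg x y φ hx hy, LinearMap.comp_apply]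
  · rw [one_smul]
    by_cases hy : y ∈ posInterval pos p (pos i)
    · exact hu x y φ hx hy
    · rw [hu0 y hy]
      rcases boundary hx hy (hX.adj x y φ) with hlt | ⟨rfl, hy⟩
      · exact (hz y hlt).elim _ _
      · exact h₁ y hy φ
  · rw [one_mul]
    by_cases hx : x ∈ posInterval pos p (pos i)
    · rw [← hg x y φ hx hy, LinearMap.comp_apply]
    · rw [hg0 x hx, LinearMap.zero_apply]
      rcases boundary hy hx (hX.adj x y φ).symm with hlt | ⟨rfl, hx⟩
      · rw [(hz x hlt).elim v 0, map_zero, map_zero]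
      · exact LinearMap.congr_fun (h₂ x hx φ) v

/-- Every vector in `P` and every functional vanishing on `Y` extends to the interval `[p, i]`.
Moving `i` along the chain, `P` and `Y` are replaced by their images or preimages, until `P ≤ Y`. -/
def Extendable (V : QuiverRep k X) (pos : X → ℕ) (p : ℕ) (i : X)
    (P Y : Submodule k (V.obj i)) : Prop :=
  (∀ v ∈ P, VecExtends V pos p i v) ∧ ∀ f ∈ Y.dualAnnihilator, FnExtends V pos p i f

theorem exists_dual_eq_one {W : Type*} [AddCommGroup W] [Module k W] {Y : Submodule k W} {v : W}
    (hv : v ∉ Y) : ∃ f ∈ Y.dualAnnihilator, f v = 1 := by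
  obtain ⟨f, hf, hY⟩ := Submodule.exists_le_ker_of_notMem hv
  refine ⟨(f v)⁻¹ • f, Submodule.smul_mem _ _ ?_, inv_mul_cancel₀ hf⟩
  exact (Submodule.mem_dualAnnihilator f).2 fun y hy => hY hy

theorem exists_comp_eq_of_mem_dualAnnihilator_comap {W W' : Type*} [AddCommGroup W] [Module k W]
    [AddCommGroup W'] [Module k W'] (T : W →ₗ[k] W') (Y : Submodule k W') {f : Module.Dual k W}
    (hf : f ∈ (Y.comap T).dualAnnihilator) : ∃ g ∈ Y.dualAnnihilator, g ∘ₗ T = f := by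
  have hker : f ∈ LinearMap.range (Y.mkQ ∘ₗ T).dualMap := by
    rwa [LinearMap.range_dualMap_eq_dualAnnihilator_ker, LinearMap.ker_comp, Submodule.ker_mkQ]
  obtain ⟨l, rfl⟩ := hker
  refine ⟨l ∘ₗ Y.mkQ, (Submodule.mem_dualAnnihilator _).2 fun y hy => ?_, rfl⟩
  rw [LinearMap.comp_apply, Submodule.mkQ_apply, (Submodule.Quotient.mk_eq_zero Y).2 hy, map_zero]

namespace Extendable

variable {P Y : Submodule k (V.obj i)}

theorem top_bot (hX : IsChainQuiver X m pos) (i : X) : Extendable V pos (pos i) i ⊤ ⊥ :=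
  ⟨fun v _ => hX.exists_isCompatibleOn_self i v, fun f _ =>
    hX.exists_isCompatibleOn_self (M := fun x => Module.Dual k (V.obj x)) i f⟩

theorem map (h : Extendable V pos p i P Y) (hX : IsChainQuiver X m pos) (hp : p ≤ pos i)
    (hij : pos j = pos i + 1) {φ : i ⟶ j} (hφ : ∀ ψ, ψ = φ) [IsEmpty (j ⟶ i)] :
    Extendable V pos p j (P.map (V.map φ)) (Y.map (V.map φ)) := by
  constructor
  · rintro _ ⟨v, hv, rfl⟩
    obtain ⟨u, hu, rfl⟩ := h.1 v hv
    exact hX.exists_isCompatibleOn_succ hp hij hu _ (fun ψ => by rw [hφ ψ]) isEmptyElim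
  · intro f hf
    have hfY : f ∘ₗ V.map φ ∈ Y.dualAnnihilator := (Submodule.mem_dualAnnihilator _).2 fun y hy =>
      (Submodule.mem_dualAnnihilator f).1 hf _ (Submodule.mem_map_of_mem hy)
    obtain ⟨g, hg, hgi⟩ := h.2 _ hfY
    exact hX.exists_isCompatibleOn_succ hp hij hg f (fun ψ => by rw [hφ ψ, hgi]) isEmptyElim

theorem comap (h : Extendable V pos p i P Y) (hX : IsChainQuiver X m pos) (hp : p ≤ pos i)
    (hij : pos j = pos i + 1) {φ : j ⟶ i} (hφ : ∀ ψ, ψ = φ) [IsEmpty (i ⟶ j)] :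
    Extendable V pos p j (P.comap (V.map φ)) (Y.comap (V.map φ)) := by
  constructor
  · intro w hw
    obtain ⟨u, hu, hui⟩ := h.1 _ hw
    exact hX.exists_isCompatibleOn_succ hp hij hu w isEmptyElim (fun ψ => by rw [hφ ψ, hui])
  · intro f hf
    obtain ⟨f', hf', rfl⟩ := exists_comp_eq_of_mem_dualAnnihilator_comap _ _ hf
    obtain ⟨g, hg, hgi⟩ := h.2 f' hf'
    exact hX.exists_isCompatibleOn_succ hp hij hg _ isEmptyElim (fun ψ => by rw [hφ ψ, hgi])

theorem exists_thinSummand_of_map_le (h : Extendable V pos p i P Y) (hX : IsChainQuiver X m pos)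
    (hz : ∀ x, pos x < p → Subsingleton (V.obj x)) (hp : p ≤ pos i) (hYP : Y < P)
    (hij : pos j = pos i + 1) {φ : i ⟶ j} (hφ : ∀ ψ, ψ = φ) [hji : IsEmpty (j ⟶ i)]
    (hle : P.map (V.map φ) ≤ Y.map (V.map φ)) :
    ∃ t : ThinSummand V (posInterval pos p (pos i)), t.IsNormalized := by
  obtain ⟨x, hxP, hxY⟩ := SetLike.exists_of_lt hYP
  obtain ⟨y, hy, hyx⟩ := hle (Submodule.mem_map_of_mem hxP)
  obtain ⟨f, hf, hf1⟩ := exists_dual_eq_one fun h =>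
    hxY (sub_add_cancel x y ▸ add_mem h hy)
  refine exists_thinSummand_of_extends hX hz hp (h.1 _ (sub_mem hxP (hYP.le hy))) (h.2 f hf) hf1
    (fun j' hj' ψ => ?_) fun j' hj' ψ => ?_ <;>
    obtain rfl : j' = j := hX.injective (hj'.trans hij.symm)
  · rw [hφ ψ, map_sub, hyx, sub_self]
  · exact isEmptyElim ψ

theorem exists_thinSummand_of_comap_le (h : Extendable V pos p i P Y)
    (hX : IsChainQuiver X m pos) (hz : ∀ x, pos x < p → Subsingleton (V.obj x)) (hp : p ≤ pos i)
    (hYP : Y < P) (hij : pos j = pos i + 1) {φ : j ⟶ i} (hφ : ∀ ψ, ψ = φ) [IsEmpty (i ⟶ j)]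
    (hle : P.comap (V.map φ) ≤ Y.comap (V.map φ)) :
    ∃ t : ThinSummand V (posInterval pos p (pos i)), t.IsNormalized := by
  obtain ⟨x, hxP, hxY⟩ := SetLike.exists_of_lt hYP
  have hx : x ∉ Y ⊔ LinearMap.range (V.map φ) := by
    intro h
    obtain ⟨y, hy, _, ⟨w, rfl⟩, rfl⟩ := Submodule.mem_sup.1 h
    exact hxY (add_mem hy (hle ((add_mem_cancel_left (hYP.le hy)).1 hxP)))
  obtain ⟨f, hf, hf1⟩ := exists_dual_eq_one hx
  rw [Submodule.dualAnnihilator_sup_eq, Submodule.mem_inf] at hf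
  refine exists_thinSummand_of_extends hX hz hp (h.1 x hxP) (h.2 f hf.1) hf1
    (fun j' hj' ψ => ?_) fun j' hj' ψ => ?_ <;>
    obtain rfl : j' = j := hX.injective (hj'.trans hij.symm)
  · exact isEmptyElim ψ
  · rw [hφ ψ]
    exact LinearMap.ext fun w => (Submodule.mem_dualAnnihilator f).1 hf.2 _ ⟨w, rfl⟩

theorem exists_thinSummand_or_succ (h : Extendable V pos p i P Y) (hX : IsChainQuiver X m pos)
    (hz : ∀ x, pos x < p → Subsingleton (V.obj x)) (hp : p ≤ pos i) (hYP : Y < P)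
    (hij : pos j = pos i + 1) :
    (∃ t : ThinSummand V (posInterval pos p (pos i)), t.IsNormalized) ∨
      ∃ P' Y' : Submodule k (V.obj j), Extendable V pos p j P' Y' ∧ Y' < P' := by
  rcases hX.edge i j hij with ⟨φ, hφ, _⟩ | ⟨φ, hφ, _⟩
  · exact or_iff_not_imp_left.2 fun hn => ⟨_, _, h.map hX hp hij hφ, Submodule.map_mono hYP.le,
      fun hle => hn (h.exists_thinSummand_of_map_le hX hz hp hYP hij hφ hle)⟩
  · exact or_iff_not_imp_left.2 fun hn => ⟨_, _, h.comap hX hp hij hφ, Submodule.comap_mono hYP.le,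
      fun hle => hn (h.exists_thinSummand_of_comap_le hX hz hp hYP hij hφ hle)⟩

theorem exists_thinSummand (hX : IsChainQuiver X m pos)
    (hz : ∀ x, pos x < p → Subsingleton (V.obj x)) (hp : p ≤ pos i)
    (h : Extendable V pos p i P Y) (hYP : Y < P) :
    ∃ q, p ≤ q ∧ q < m ∧ ∃ t : ThinSummand V (posInterval pos p q), t.IsNormalized := by
  obtain ⟨d, hd⟩ := Nat.exists_eq_add_of_lt (hX.lt i)
  induction d generalizing i with
  | zero =>
    obtain ⟨x, hxP, hxY⟩ := SetLike.exists_of_lt hYP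
    obtain ⟨f, hf, hf1⟩ := exists_dual_eq_one hxY
    have hlast (j : X) : pos j ≠ pos i + 1 := by
      have := hX.lt j
      omega
    exact ⟨pos i, hp, hX.lt i, exists_thinSummand_of_extends hX hz hp (h.1 x hxP) (h.2 f hf) hf1
      (fun j hj => absurd hj (hlast j)) fun j hj => absurd hj (hlast j)⟩
  | succ d ih =>
    obtain ⟨j, hj⟩ := hX.surj (pos i + 1) (by omega)
    rcases h.exists_thinSummand_or_succ hX hz hp hYP hj with ht | ⟨P', Y', h', hYP'⟩
    · exact ⟨pos i, hp, hX.lt i, ht⟩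
    · exact ih (by omega) h' hYP' (by omega)

end Extendable

theorem exists_thinSummand_posInterval (hX : IsChainQuiver X m pos) (hV : ¬ V.IsZero) :
    ∃ p q, p ≤ q ∧ q < m ∧ ∃ t : ThinSummand V (posInterval pos p q), t.IsNormalized := by
  classical
  have hex : ∃ p, ∃ x, pos x = p ∧ Nontrivial (V.obj x) := by
    obtain ⟨x, hx⟩ := not_forall.1 hV
    exact ⟨_, x, rfl, not_subsingleton_iff_nontrivial.1 hx⟩
  obtain ⟨i, hi, _⟩ := Nat.find_spec hex
  have hz (x : X) (hx : pos x < pos i) : Subsingleton (V.obj x) :=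
    not_nontrivial_iff_subsingleton.1 fun h => Nat.find_min hex (hi ▸ hx) ⟨x, rfl, h⟩
  exact ⟨pos i, (Extendable.top_bot hX i).exists_thinSummand hX hz le_rfl bot_lt_top⟩

end QuiverRep

/-! ### Indecomposable symmetric representations of symmetric chains -/

namespace SignedQuiver

/-- `Q̃` is a chain of `2c + 1` vertices which the involution reverses, without signed arrows, and
with middle vertex of sign `s`. -/
structure IsSymmetricChain (Q : SignedQuiver) (c : ℕ) (pos : Q.Double → ℕ) (s : SignType) :
    Prop where
  chain : IsChainQuiver Q.Double (2 * c + 1) pos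
  pos_star : ∀ i, pos i.star + pos i = 2 * c
  arrow_sign : ∀ a : Q.DoubleArrow, a.sign = 0
  sign_of_fixed : ∀ i : Q.Double, i.star = i → i.sign = s

variable {Q : SignedQuiver} {c p q : ℕ} {pos : Q.Double → ℕ} {s : SignType}

namespace IsSymmetricChain

theorem star_preimage_posInterval (hQ : Q.IsSymmetricChain c pos s) (hp : p ≤ 2 * c)
    (hq : q ≤ 2 * c) :
    Double.star ⁻¹' posInterval pos p q = posInterval pos (2 * c - q) (2 * c - p) := by
  ext i
  have := hQ.pos_star i
  simp only [posInterval, Set.mem_preimage, Set.mem_ofPred_eq]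
  omega

theorem star_preimage_posInterval_eq_self (hQ : Q.IsSymmetricChain c pos s) (hpq : p ≤ q)
    (hq : q ≤ 2 * c) :
    Double.star ⁻¹' posInterval pos p q = posInterval pos p q ↔ p + q = 2 * c := by
  rw [hQ.star_preimage_posInterval (hpq.trans hq) hq]
  constructor
  · intro h
    obtain ⟨x, hx⟩ := hQ.chain.surj p (by omega)
    obtain ⟨y, hy⟩ := hQ.chain.surj q (by omega)
    have hx' : x ∈ posInterval pos (2 * c - q) (2 * c - p) := h.ge ⟨hx.ge, hx.trans_le hpq⟩
    have hy' : y ∈ posInterval pos (2 * c - q) (2 * c - p) := h.ge ⟨hpq.trans hy.ge, hy.le⟩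
    have := hx'.1
    have := hy'.2
    omega
  · intro h
    congr 1 <;> omega

theorem connectedOn_star_preimage (hQ : Q.IsSymmetricChain c pos s) (hpq : p ≤ q)
    (hq : q ≤ 2 * c) : QuiverRep.ConnectedOn (Double.star ⁻¹' posInterval pos p q) := by
  rw [hQ.star_preimage_posInterval (hpq.trans hq) hq]
  exact hQ.chain.connectedOn_posInterval (by omega) (by omega)

theorem star_eq_self_iff (hQ : Q.IsSymmetricChain c pos s) (i : Q.Double) :
    i.star = i ↔ pos i = c := by
  have := hQ.pos_star i
  rw [← hQ.chain.injective.eq_iff]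
  omega

theorem sign_ne_neg_one (hQ : Q.IsSymmetricChain c pos 1) (i : Q.Double) : i.sign ≠ -1 := by
  by_cases h : i.star = i
  · rw [hQ.sign_of_fixed i h]
    decide
  · rw [Double.sign_eq_zero_of_star_ne h]
    decide

theorem vertexSign_eq_one (hQ : Q.IsSymmetricChain c pos 1) (i : Q.Double) : vertexSign i = 1 :=
  if_neg (hQ.sign_ne_neg_one i)

theorem dualSign_eq_one (hQ : Q.IsSymmetricChain c pos 1) {i j : Q.Double} (φ : i ⟶ j) :
    dualSign φ = 1 := by
  have hφ : φ.1.sign ≠ -1 := by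
    rw [hQ.arrow_sign]
    decide
  exact if_neg (by simp only [hφ, hQ.sign_ne_neg_one j, ne_eq, false_and, and_false, or_false,
    not_false_eq_true])

end IsSymmetricChain

open Classical in
/-- The dimension vector of the indecomposable symmetric representation attached to the thin
representation with support `S`. -/
noncomputable def rootDim (s : SignType) (S : Set Q.Double) : Q.Double → ℕ :=
  if s = 1 ∧ Double.star ⁻¹' S = S then S.indicator 1
  else S.indicator 1 + (Double.star ⁻¹' S).indicator 1

theorem rootDim_star_preimage (s : SignType) (S : Set Q.Double) :
    rootDim s (Double.star ⁻¹' S) = rootDim s S := by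
  have h : Double.star ⁻¹' (Double.star ⁻¹' S) = S :=
    Set.ext fun i => by rw [Set.mem_preimage, Set.mem_preimage, Double.star_star]
  unfold rootDim
  rw [h]
  exact ite_congr (by rw [eq_comm (a := S)]) (fun hS => by rw [hS.2]) fun _ => add_comm _ _

theorem rootDim_ne_zero (s : SignType) {S : Set Q.Double} {i : Q.Double} (hi : i ∈ S) :
    rootDim s S i ≠ 0 := by
  unfold rootDim
  split_ifs <;> simp [hi]

end SignedQuiver

namespace QuiverRep

open SignedQuiver

variable {k : Type u} [Field k] {Q : SignedQuiver} {c p q : ℕ} {pos : Q.Double → ℕ}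
  {s : SignType} {V : QuiverRep k Q.Double}

theorem pairing_dual_eq_zero (hk : (2 : k) ≠ 0) (hQ : Q.IsSymmetricChain c pos s) {J : SignedForm V}
    (hJ : IsHom V V.dual J.toDual) (hpq : p ≤ q) (hq : q ≤ 2 * c)
    (hn : ¬ (s = 1 ∧ Double.star ⁻¹' posInterval pos p q = posInterval pos p q))
    (t : ThinSummand V (posInterval pos p q)) (i : Q.Double) :
    t.pairing (t.dual J hJ) i = 0 := by
  by_contra hne
  have hS := hQ.chain.connectedOn_posInterval hpq (Nat.lt_succ_of_le hq)
  have hself := (t.eq_of_pairing_ne_zero _ hS (hQ.connectedOn_star_preimage hpq hq) hne).symm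
  have hsum := (hQ.star_preimage_posInterval_eq_self hpq hq).1 hself
  obtain ⟨x, hx⟩ := hQ.chain.surj c (by omega)
  have hfix : x.star = x := (hQ.star_eq_self_iff x).2 hx
  have hsign : x.sign = -1 := by
    have h0 := Double.sign_ne_zero_of_star_eq hfix
    have h1 : x.sign ≠ 1 := fun h => hn ⟨hQ.sign_of_fixed x hfix ▸ h, hself⟩
    generalize x.sign = σ at h0 h1
    revert σ
    decide
  have halt : J.form x x hfix (t.vec x) (t.vec x) = 0 := by
    have hneg := J.form_of_fixed x hfix (t.vec x) (t.vec x)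
    rw [hsign, SignType.coe_neg, SignType.coe_one] at hneg
    exact (mul_eq_zero.1 (by linear_combination hneg)).resolve_left hk
  apply hne
  have hi : i ∈ posInterval pos p q := not_imp_comm.1 (t.pairing_eq_zero_of_notMem _) hne
  have hx' : x ∈ posInterval pos p q := ⟨by omega, by omega⟩
  rw [t.pairing_eq _ hS hi hx', ThinSummand.pairing, ← t.form_vec J hJ hfix, halt, zero_mul]

open Classical in
theorem exists_nondegenerateOn (hk : (2 : k) ≠ 0) (hQ : Q.IsSymmetricChain c pos s)
    (hV : ¬ V.IsZero) {J : SignedForm V} (hJ : IsHom V V.dual J.toDual) :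
    ∃ p q, p ≤ q ∧ q ≤ 2 * c ∧ Nonempty (ThinSummand V (posInterval pos p q)) ∧
      ∃ N, V.IsSubrep N ∧ J.NondegenerateOn N ∧
        ∀ i, Module.finrank k (N i) = rootDim s (posInterval pos p q) i := by
  obtain ⟨p, q, hpq, hq, t, ht⟩ := exists_thinSummand_posInterval hQ.chain hV
  have hq' : q ≤ 2 * c := Nat.le_of_lt_succ hq
  refine ⟨p, q, hpq, hq', ⟨t⟩, ?_⟩
  by_cases hn : s = 1 ∧ Double.star ⁻¹' posInterval pos p q = posInterval pos p q
  · obtain ⟨rfl, hself⟩ := hn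
    obtain ⟨v, hv, h0⟩ := exists_isThinFamily hk (hQ.chain.connectedOn_posInterval hpq hq) hself hJ
      hQ.dualSign_eq_one hQ.vertexSign_eq_one t ht
    refine ⟨_, hv.isSubrep_span, hv.nondegenerateOn_span h0, fun i => ?_⟩
    rw [hv.finrank_span h0, rootDim, if_pos (And.intro rfl hself), Set.indicator_apply,
      Pi.one_apply]
  · have hp := pairing_dual_eq_zero hk hQ hJ hpq hq' hn t
    refine ⟨_, t.isSubrep_span_pair (t.dual J hJ), ThinSummand.nondegenerateOn_span_dual hJ hp,
      fun i => ?_⟩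
    rw [t.finrank_span_pair _ (hp i), rootDim, if_neg hn, Pi.add_apply, Set.indicator_apply,
      Set.indicator_apply, Pi.one_apply]

theorem isIndecomposableSymmetric_of_thinSummand (hk : (2 : k) ≠ 0)
    (hQ : Q.IsSymmetricChain c pos s) (hV : V.IsSymmetric) (h0 : ¬ V.IsZero)
    (h : ∀ p q, p ≤ q → q ≤ 2 * c → ThinSummand V (posInterval pos p q) →
      ∀ i, rootDim s (posInterval pos p q) i = Module.finrank k (V.obj i)) :
    V.IsIndecomposableSymmetric := by
  refine ⟨hV, h0, fun A B ⟨J, hJ⟩ _ hAB => or_iff_not_imp_left.2 fun hA i => ?_⟩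
  obtain ⟨p, q, hpq, hq, ⟨t⟩, N, -, -, hN⟩ := exists_nondegenerateOn hk hQ hA hJ
  obtain ⟨t'⟩ := (t.inl B).nonempty_of_isomorphic hAB
  have hdim := hAB.finrank_eq i
  rw [finrank_directSum, ← h p q hpq hq t', ← hN] at hdim
  have hle := Submodule.finrank_le (N i)
  exact Module.finrank_zero_iff.1 (by omega : Module.finrank k (B.obj i) = 0)

section Thin

variable (k) {X : Type} (S : Set X)

open Classical in
/-- The coordinate of the space `k` or `0` carried by the thin representation at `i`. -/
noncomputable def thinCoord (i : X) : Module.Dual k (PLift (i ∈ S) → k) :=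
  if h : i ∈ S then LinearMap.proj ⟨h⟩ else 0

variable {k S}

theorem thinCoord_apply {i : X} (hi : i ∈ S) (x : PLift (i ∈ S) → k) :
    thinCoord k S i x = x ⟨hi⟩ := by
  rw [thinCoord, dif_pos hi, LinearMap.proj_apply]

variable (k S) [Quiver.{0, 0} X]

/-- The thin representation with support `S`, all of whose arrows inside `S` act by the scalar one.
Its space at `i` is `k` or `0`, encoded as the space of functions on the proofs of `i ∈ S`. -/
noncomputable def thin : QuiverRep k X where
  obj i := PLift (i ∈ S) → k
  map {i _} _ := LinearMap.pi fun _ => thinCoord k S i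

/-- The thin representation as a thin summand of itself. -/
noncomputable def thinSummandThin : ThinSummand (thin k S) S where
  vec _ := fun _ => (1 : k)
  fn i := thinCoord k S i
  scal _ := 1
  scal_ne_zero _ := one_ne_zero
  vec_eq_zero _ hi := funext fun h => absurd h.down hi
  fn_eq_zero _ hi := dif_neg hi
  fn_vec _ hi := thinCoord_apply hi _
  map_vec _ hi := funext fun _ => (thinCoord_apply hi _).trans (one_mul (1 : k)).symm
  fn_map _ hj _ := (thinCoord_apply hj _).trans (one_mul _).symm

theorem spans_thinSummandThin : (thinSummandThin k S).Spans := fun _ x => funext fun h =>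
  (thinCoord_apply h.down x).symm.trans (mul_one _).symm

end Thin

theorem rootDim_eq_of_thinSummand_hyperbolic (hQ : Q.IsSymmetricChain c pos s) {p' q' : ℕ}
    (hpq : p ≤ q) (hq : q ≤ 2 * c) (hpq' : p' ≤ q') (hq' : q' ≤ 2 * c)
    {t : ThinSummand V (posInterval pos p q)} (ht : t.Spans)
    (t' : ThinSummand (V.directSum V.dual) (posInterval pos p' q')) :
    rootDim s (posInterval pos p' q') = rootDim s (posInterval pos p q) := by
  have hS := hQ.chain.connectedOn_posInterval hpq (Nat.lt_succ_of_le hq)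
  have hS' := hQ.chain.connectedOn_posInterval hpq' (Nat.lt_succ_of_le hq')
  rcases t'.eq_or_eq_of_directSum ht ht.dualRep hS' hS (hQ.connectedOn_star_preimage hpq hq)
    with h | h
  · rw [h]
  · rw [h, rootDim_star_preimage]

theorem exists_isIndecomposableSymmetric (hk : (2 : k) ≠ 0) (hQ : Q.IsSymmetricChain c pos s)
    (hpq : p ≤ q) (hq : q ≤ 2 * c) :
    ∃ V : QuiverRep k Q.Double, V.IsIndecomposableSymmetric ∧
      ∀ i, Module.finrank k (V.obj i) = rootDim s (posInterval pos p q) i := by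
  let W := thin k (posInterval pos p q)
  have hW : (thinSummandThin k (posInterval pos p q)).Spans := spans_thinSummandThin k _
  obtain ⟨i, hi⟩ := (hQ.chain.connectedOn_posInterval hpq (Nat.lt_succ_of_le hq)).1
  have h0 : ¬ (W.directSum W.dual).IsZero := fun h =>
    ((thinSummandThin k _).inl W.dual).vec_ne_zero hi ((h i).elim _ _)
  obtain ⟨J, hJ⟩ := isSymmetric_hyperbolic W
  obtain ⟨p', q', hpq', hq', ⟨t⟩, N, hN, hnd, hdim⟩ := exists_nondegenerateOn hk hQ h0 hJ
  rw [rootDim_eq_of_thinSummand_hyperbolic hQ hpq hq hpq' hq' hW t] at hdim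
  refine ⟨_, isIndecomposableSymmetric_of_thinSummand hk hQ (hnd.isSymmetric_sub hJ hN)
    (fun h => ?_) fun a b hab hb t' j => ?_, hdim⟩
  · have : Subsingleton (N i) := h i
    exact rootDim_ne_zero s hi ((hdim i).symm.trans Module.finrank_zero_of_subsingleton)
  · obtain ⟨t''⟩ := (t'.inl _).nonempty_of_isomorphic
      (isomorphic_directSum_sub _ hN (SignedForm.isSubrep_perp hJ hN) hnd.isCompl_perp)
    rw [rootDim_eq_of_thinSummand_hyperbolic hQ hpq hq hab hb hW t'']
    exact (hdim j).symm

end QuiverRep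

theorem SignedQuiver.symDims_eq {k : Type u} [Field k] (hk : (2 : k) ≠ 0) {Q : SignedQuiver}
    {c : ℕ} {pos : Q.Double → ℕ} {s : SignType} (hQ : Q.IsSymmetricChain c pos s) :
    symDims k Q = {d | ∃ p q, p ≤ q ∧ q ≤ 2 * c ∧
      ∀ i, d i = (rootDim s (posInterval pos p q) i : ℚ)} := by
  ext d
  constructor
  · rintro ⟨V, hV, hd⟩
    obtain ⟨J, hJ⟩ := hV.1
    obtain ⟨p, q, hpq, hq, -, N, hN, hnd, hdim⟩ :=
      QuiverRep.exists_nondegenerateOn hk hQ hV.2.1 hJ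
    obtain ⟨i₀, hi₀⟩ := (hQ.chain.connectedOn_posInterval hpq (Nat.lt_succ_of_le hq)).1
    have h0 : N i₀ ≠ ⊥ := fun h =>
      rootDim_ne_zero s hi₀ ((hdim i₀).symm.trans (Submodule.finrank_eq_zero.2 h))
    refine ⟨p, q, hpq, hq, fun i => ?_⟩
    rw [hd i, ← hdim i, hV.eq_top hJ hN hnd h0 i, finrank_top]
  · rintro ⟨p, q, hpq, hq, hd⟩
    obtain ⟨V, hV, hdim⟩ := QuiverRep.exists_isIndecomposableSymmetric hk hQ hpq hq
    exact ⟨V, hV, fun i => by rw [hd i, hdim i]⟩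

/-! ### Root systems from sets of vectors -/

section Base

variable {ι R M N : Type*} [CommRing R] [AddCommGroup M] [Module R M] [AddCommGroup N] [Module R N]
  {P : RootPairing ι R M N} (b : P.Base)

theorem exists_sum_root_eq_of_mem_closure {x : M}
    (hx : x ∈ AddSubmonoid.closure (P.root '' b.support)) :
    ∃ f : ι → ℤ, 0 ≤ f ∧ x = ∑ j ∈ b.support, f j • P.root j := by
  classical
  induction hx using AddSubmonoid.closure_induction with
  | mem x hx =>
    obtain ⟨j, hj, rfl⟩ := hx
    refine ⟨Pi.single j 1, Pi.single_nonneg.2 zero_le_one, ?_⟩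
    rw [Finset.sum_eq_single_of_mem j hj fun i _ hij => by rw [Pi.single_eq_of_ne hij, zero_smul],
      Pi.single_eq_same, one_smul]
  | zero => exact ⟨0, le_rfl, by simp⟩
  | add x y _ _ hx hy =>
    obtain ⟨f, hf, rfl⟩ := hx
    obtain ⟨g, hg, rfl⟩ := hy
    exact ⟨f + g, add_nonneg hf hg, by simp [add_smul, Finset.sum_add_distrib]⟩

variable [CharZero R] {i : ι}

theorem isPos_of_root_mem_closure
    (hi : P.root i ∈ AddSubmonoid.closure (P.root '' b.support)) : b.IsPos i := by
  obtain ⟨f, hf, h⟩ := exists_sum_root_eq_of_mem_closure b hi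
  rw [b.isPos_iff', b.height_eq_sum h]
  exact Finset.sum_nonneg fun j _ => hf j

theorem not_isPos_of_neg_root_mem_closure
    (hi : -P.root i ∈ AddSubmonoid.closure (P.root '' b.support)) : ¬ b.IsPos i := by
  obtain ⟨f, hf, h⟩ := exists_sum_root_eq_of_mem_closure b hi
  have h' : P.root i = ∑ j ∈ b.support, (-f) j • P.root j := by
    rw [← neg_neg (P.root i), h, ← Finset.sum_neg_distrib]
    simp only [Pi.neg_apply, neg_smul]
  rw [b.isPos_iff, b.height_eq_sum h', not_lt]
  exact Finset.sum_nonpos fun j _ => neg_nonpos.2 (hf j)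

end Base

section RootSets

open LinearMap (BilinForm)

variable {K M M' ι : Type*} [Field K] [AddCommGroup M] [Module K M] [AddCommGroup M'] [Module K M']

/-- The coroot `2 (x, ·) / (x, x)` of a vector `x` with respect to a bilinear form. -/
noncomputable def formCoroot (B : BilinForm K M) (x : M) : Module.Dual K M := (2 / B x x) • B x

theorem formCoroot_apply (B : BilinForm K M) (x y : M) :
    formCoroot B x y = 2 / B x x * B x y := rfl

theorem formCoroot_apply_self {B : BilinForm K M} {x : M} (hx : B x x ≠ 0) :
    formCoroot B x x = 2 := div_mul_cancel₀ _ hx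

theorem form_reflection {B : BilinForm K M} (hB : B.IsSymm) {x : M} (hx : B x x ≠ 0) (y : M) :
    B (y - formCoroot B x y • x) (y - formCoroot B x y • x) = B y y := by
  simp only [map_sub, map_smul, LinearMap.sub_apply, LinearMap.smul_apply, smul_eq_mul, hB.eq y x,
    formCoroot_apply]
  field_simp
  ring

theorem formCoroot_injOn {B : BilinForm K M} (hani : ∀ x, B x x = 0 → x = 0)
    (h2 : (2 : K) ≠ 0) : Set.InjOn (formCoroot B) {x | x ≠ 0} := by
  intro x hx y hy h
  have hx' : B x x ≠ 0 := mt (hani x) hx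
  have hy' : B y y ≠ 0 := mt (hani y) hy
  have hxy : formCoroot B x y = 2 := by rw [h, formCoroot_apply_self hy']
  have hyx : formCoroot B y x = 2 := by rw [← h, formCoroot_apply_self hx']
  rw [formCoroot_apply, div_mul_eq_mul_div, div_eq_iff hx', mul_right_inj' h2] at hxy
  rw [formCoroot_apply, div_mul_eq_mul_div, div_eq_iff hy', mul_right_inj' h2] at hyx
  refine sub_eq_zero.1 (hani _ ?_)
  rw [map_sub, map_sub, LinearMap.sub_apply, LinearMap.sub_apply, hxy, hyx]
  ring

/-- `R` is a finite, reduced, crystallographic root system with respect to the anisotropic symmetric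
bilinear form `B`. -/
structure IsRootSet (B : BilinForm K M) (R : Set M) : Prop where
  isSymm : B.IsSymm
  anisotropic : ∀ x, B x x = 0 → x = 0
  finite : R.Finite
  span_eq_top : Submodule.span K R = ⊤
  zero_notMem : 0 ∉ R
  reflection_mem : ∀ x ∈ R, ∀ y ∈ R, y - formCoroot B x y • x ∈ R
  exists_int : ∀ x ∈ R, ∀ y ∈ R, ∃ z : ℤ, (z : K) = formCoroot B y x
  eq_one_or_neg_one : ∀ x ∈ R, ∀ c : K, c • x ∈ R → c = 1 ∨ c = -1

/-- `α` is a system of simple roots of `R`, for which `S` is the set of positive roots. -/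
structure IsSimpleSystem (K : Type*) [Field K] [Module K M] (R S : Set M) (α : ι → M) : Prop where
  linearIndependent : LinearIndependent K α
  mem : ∀ i, α i ∈ S
  mem_iff : ∀ x, x ∈ R ↔ x ∈ S ∨ -x ∈ S
  subset_closure : S ⊆ AddSubmonoid.closure (Set.range α)

theorem IsSimpleSystem.map {R S : Set M} {α : ι → M} (h : IsSimpleSystem K R S α)
    {f : M →ₗ[K] M'} (hf : Function.Injective f) :
    IsSimpleSystem K (f '' R) (f '' S) (f ∘ α) where
  linearIndependent := h.linearIndependent.map' _ (LinearMap.ker_eq_bot.2 hf)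
  mem i := Set.mem_image_of_mem f (h.mem i)
  mem_iff y := by
    refine ⟨?_, ?_⟩
    · rintro ⟨x, hx, rfl⟩
      rw [← map_neg, hf.mem_set_image, hf.mem_set_image]
      exact (h.mem_iff x).1 hx
    · rintro (⟨x, hx, rfl⟩ | ⟨x, hx, hxy⟩)
      · exact ⟨x, (h.mem_iff x).2 (Or.inl hx), rfl⟩
      · exact ⟨-x, (h.mem_iff _).2 (Or.inr (by rwa [neg_neg])), by rw [map_neg, hxy, neg_neg]⟩
  subset_closure := by
    rintro _ ⟨x, hx, rfl⟩
    have hx' := AddSubmonoid.mem_map_of_mem (f : M →+ M') (h.subset_closure hx)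
    rwa [AddMonoidHom.map_mclosure, ← Set.range_comp] at hx'

namespace IsSimpleSystem

variable {R S : Set M} {α : ι → M}

/-- The simple roots as elements of the set of roots. -/
def toRoot (hα : IsSimpleSystem K R S α) (i : ι) : R :=
  ⟨α i, (hα.mem_iff _).2 (Or.inl (hα.mem i))⟩

theorem toRoot_injective (hα : IsSimpleSystem K R S α) : Function.Injective hα.toRoot :=
  fun _ _ h => hα.linearIndependent.injective (congrArg Subtype.val h)

theorem span_eq_top (hα : IsSimpleSystem K R S α) (hR : Submodule.span K R = ⊤) :
    Submodule.span K S = ⊤ := by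
  rw [eq_top_iff, ← hR, Submodule.span_le]
  intro x hx
  rcases (hα.mem_iff x).1 hx with hx | hx
  · exact Submodule.subset_span hx
  · exact (Submodule.neg_mem_iff _).1 (Submodule.subset_span hx)

end IsSimpleSystem

theorem form_congr_apply_apply (B : BilinForm K M) (e : M ≃ₗ[K] M') (x y : M) :
    BilinForm.congr e B (e x) (e y) = B x y := by
  rw [BilinForm.congr_apply, e.symm_apply_apply, e.symm_apply_apply]

theorem formCoroot_congr_apply (B : BilinForm K M) (e : M ≃ₗ[K] M') (x y : M) :
    formCoroot (BilinForm.congr e B) (e x) (e y) = formCoroot B x y := by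
  rw [formCoroot_apply, formCoroot_apply, form_congr_apply_apply, form_congr_apply_apply]

namespace IsRootSet

variable {B : BilinForm K M} {R S : Set M} {α : ι → M}

theorem map (h : IsRootSet B R) (e : M ≃ₗ[K] M') :
    IsRootSet (BilinForm.congr e B) (e '' R) := by
  refine ⟨⟨fun x y => h.isSymm.eq _ _⟩, fun x hx => ?_, h.finite.image e, ?_, ?_, ?_, ?_, ?_⟩
  · exact (LinearEquiv.map_eq_zero_iff _).1 (h.anisotropic (e.symm x) hx)
  · rw [← LinearEquiv.coe_coe, Submodule.span_image, h.span_eq_top, Submodule.map_top,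
      LinearEquiv.range]
  · rw [← map_zero e, e.injective.mem_set_image]
    exact h.zero_notMem
  · rintro _ ⟨x, hx, rfl⟩ _ ⟨y, hy, rfl⟩
    exact ⟨_, h.reflection_mem x hx y hy, by rw [map_sub, map_smul, formCoroot_congr_apply]⟩
  · rintro _ ⟨x, hx, rfl⟩ _ ⟨y, hy, rfl⟩
    rw [formCoroot_congr_apply]
    exact h.exists_int x hx y hy
  · rintro _ ⟨x, hx, rfl⟩ c hc
    rw [← map_smul, e.injective.mem_set_image] at hc
    exact h.eq_one_or_neg_one x hx c hc

theorem form_ne_zero (h : IsRootSet B R) {x : M} (hx : x ∈ R) : B x x ≠ 0 := fun h0 =>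
  h.zero_notMem (h.anisotropic x h0 ▸ hx)

theorem moduleFinite (h : IsRootSet B R) : Module.Finite K M :=
  ⟨⟨h.finite.toFinset, by rw [Set.Finite.coe_toFinset, h.span_eq_top]⟩⟩

theorem span_range_subtype (h : IsRootSet B R) :
    Submodule.span K (Set.range (Function.Embedding.subtype (· ∈ R))) = ⊤ :=
  (congrArg _ Subtype.range_coe).trans h.span_eq_top

variable [CharZero K]

/-- The root pairing on `M` and its dual space attached to a root system in `M`. -/
noncomputable def rootPairing (h : IsRootSet B R) : RootPairing R K M (Module.Dual K M) :=
  have := h.finite.to_subtype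
  have := h.moduleFinite
  RootPairing.mk'' (Module.Dual.eval K M) (Function.Embedding.subtype (· ∈ R))
    ⟨fun x => formCoroot B x, fun x y hxy => Subtype.ext (formCoroot_injOn h.anisotropic
      two_ne_zero (ne_of_mem_of_not_mem x.2 h.zero_notMem)
      (ne_of_mem_of_not_mem y.2 h.zero_notMem) hxy)⟩
    (fun x => formCoroot_apply_self (h.form_ne_zero x.2))
    (fun x => by
      rintro _ ⟨y, rfl⟩
      exact ⟨⟨_, h.reflection_mem x x.2 y y.2⟩, rfl⟩)
    h.span_range_subtype

theorem rootPairing_root (h : IsRootSet B R) (x : R) : h.rootPairing.root x = x := rfl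

theorem isRootSystem (h : IsRootSet B R) : h.rootPairing.IsRootSystem :=
  have := h.finite.to_subtype
  have := h.moduleFinite
  RootPairing.isRootSystem_mk'' (ι := R) (hsp := h.span_range_subtype)
    fun x y => h.exists_int x x.2 y y.2

theorem isCrystallographic (h : IsRootSet B R) : h.rootPairing.IsCrystallographic :=
  ⟨fun x y => h.exists_int x x.2 y y.2⟩

theorem isReduced (h : IsRootSet B R) : h.rootPairing.IsReduced := by
  refine ⟨fun x y hxy => ?_⟩
  rw [LinearIndependent.pair_iff' (h.rootPairing.ne_zero x)] at hxy
  push Not at hxy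
  obtain ⟨c, hc⟩ := hxy
  rw [rootPairing_root, rootPairing_root] at hc ⊢
  rcases h.eq_one_or_neg_one x x.2 c (hc ▸ y.2) with rfl | rfl
  · exact Or.inl (by rw [← hc, one_smul])
  · exact Or.inr (by rw [← hc, neg_one_smul, neg_neg])

theorem image_root_range_toRoot (h : IsRootSet B R) (hα : IsSimpleSystem K R S α) :
    h.rootPairing.root '' Set.range hα.toRoot = Set.range α := (Set.range_comp _ _).symm

/-- The base of the root pairing given by a system of simple roots. -/
noncomputable def base (h : IsRootSet B R) (hα : IsSimpleSystem K R S α) : h.rootPairing.Base :=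
  have := h.finite.to_subtype
  have := h.isRootSystem
  have := h.isCrystallographic
  have := h.isReduced
  RootPairing.Base.mk' h.rootPairing (Set.range hα.toRoot)
    ((linearIndepOn_range_iff hα.toRoot_injective _).2 hα.linearIndependent)
    fun x => by
      rw [h.image_root_range_toRoot]
      exact ((hα.mem_iff x).1 x.2).imp (hα.subset_closure ·) (hα.subset_closure ·)

theorem coe_support_base (h : IsRootSet B R) (hα : IsSimpleSystem K R S α) :
    ((h.base hα).support : Set R) = Set.range hα.toRoot := Set.Finite.coe_toFinset _

theorem isPos_base_iff (h : IsRootSet B R) (hα : IsSimpleSystem K R S α) (x : R) :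
    (h.base hα).IsPos x ↔ (x : M) ∈ S := by
  have hmem {y : M} (hy : y ∈ S) :
      y ∈ AddSubmonoid.closure (h.rootPairing.root '' (h.base hα).support) := by
    rw [coe_support_base, image_root_range_toRoot]
    exact hα.subset_closure hy
  refine ⟨fun hx => ((hα.mem_iff x).1 x.2).resolve_right fun hneg => ?_, fun hx => ?_⟩
  · exact not_isPos_of_neg_root_mem_closure _ (hmem hneg) hx
  · exact isPos_of_root_mem_closure _ (hmem hx)

theorem image_root_isPos_base (h : IsRootSet B R) (hα : IsSimpleSystem K R S α) :
    h.rootPairing.root '' {x | (h.base hα).IsPos x} = S := by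
  ext x
  refine ⟨?_, fun hx => ⟨⟨x, (hα.mem_iff x).2 (Or.inl hx)⟩, (h.isPos_base_iff hα _).2 hx, rfl⟩⟩
  rintro ⟨x, hx, rfl⟩
  exact (h.isPos_base_iff hα x).1 hx

/-- The simple roots are indexed by the support of the base. -/
noncomputable def supportBaseEquiv (h : IsRootSet B R) (hα : IsSimpleSystem K R S α) :
    ι ≃ (h.base hα).support :=
  (Equiv.ofInjective _ hα.toRoot_injective).trans (Equiv.setCongr (h.coe_support_base hα).symm)

theorem cartanMatrix_base (h : IsRootSet B R) (hα : IsSimpleSystem K R S α)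
    [h.rootPairing.IsCrystallographic] (i j : ι) :
    ((h.base hα).cartanMatrix (h.supportBaseEquiv hα i) (h.supportBaseEquiv hα j) : K) =
      formCoroot B (α j) (α i) :=
  (h.base hα).algebraMap_cartanMatrixIn_apply ℤ _ _

end IsRootSet

end RootSets

theorem isPositiveRootsOfType_of_isRootSet {M : Type*} [AddCommGroup M] [Module ℚ M]
    {B : LinearMap.BilinForm ℚ M} {R S : Set M} {X : Type} {n : ℕ} {α : Fin n → M}
    {A : Matrix (Fin n) (Fin n) ℤ}
    (h : IsRootSet B R) (hα : IsSimpleSystem ℚ R S α)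
    (hA : ∀ i j, (A i j : ℚ) = formCoroot B (α j) (α i))
    (Φ : M →ₗ[ℚ] X → ℚ) (hΦ : Function.Injective Φ) :
    IsPositiveRootsOfType (Φ '' S) A (fun i => Φ (α i)) := by
  have hrange : LinearMap.range Φ = Submodule.span ℚ (Φ '' S) := by
    rw [Submodule.span_image, hα.span_eq_top h.span_eq_top, Submodule.map_top]
  let e : M ≃ₗ[ℚ] Submodule.span ℚ (Φ '' S) :=
    (LinearEquiv.ofInjective Φ hΦ).trans (LinearEquiv.ofEq _ _ hrange)
  have hcoe (T : Set M) : (Subtype.val '' (e '' T) : Set (X → ℚ)) = Φ '' T := Set.image_image _ _ T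
  have he := h.map e
  have hαe : IsSimpleSystem ℚ (e '' R) (e '' S) (e ∘ α) := hα.map (f := e.toLinearMap) e.injective
  have hcr := he.isCrystallographic
  refine ⟨e '' R, he.finite, he.rootPairing, he.isRootSystem, hcr, he.isReduced, he.base hαe,
    he.supportBaseEquiv hαe, ?_, ?_, fun i => rfl, fun i j => ?_⟩
  · calc Set.range (fun x : e '' R => ((x : Submodule.span ℚ (Φ '' S)) : X → ℚ))
        = Subtype.val '' (e '' R) := (Set.image_eq_range _ _).symm
      _ = Φ '' R := hcoe R
      _ = Φ '' S ∪ {d | -d ∈ Φ '' S} := Set.ext (hα.map hΦ).mem_iff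
  · exact (Set.image_image Subtype.val _ _).symm.trans
      ((congrArg _ (he.image_root_isPos_base hαe)).trans (hcoe S))
  · have hcartan := he.cartanMatrix_base hαe i j
    rw [Function.comp_apply, Function.comp_apply, formCoroot_congr_apply, ← hA] at hcartan
    exact Int.cast_injective hcartan

/-! ### The roots of types `B` and `C` -/

section ChainRoots

open Matrix

variable {ι : Type*}

variable (ι) in
/-- The coercion of integral vectors to rational vectors. -/
def intCastVec : (ι → ℤ) →+ (ι → ℚ) := (Int.castAddHom ℚ).compLeft ι

variable (ι) in
/-- The integral vectors of `ℚ^ι`. -/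
def integralVectors : AddSubgroup (ι → ℚ) := (intCastVec ι).range

theorem intCastVec_single [DecidableEq ι] (a : ι) (m : ℤ) :
    intCastVec ι (Pi.single a m) = Pi.single a (m : ℚ) :=
  funext fun b => Pi.apply_single (fun _ : ι => (Int.cast : ℤ → ℚ)) (fun _ => Int.cast_zero) a m b

theorem single_mem_integralVectors [DecidableEq ι] (a : ι) :
    (Pi.single a 1 : ι → ℚ) ∈ integralVectors ι :=
  ⟨Pi.single a 1, (intCastVec_single a 1).trans (by rw [Int.cast_one])⟩

variable [Fintype ι]

theorem exists_dotProduct_sub_single [DecidableEq ι] {x : ι → ℤ} (h0 : x ≠ 0) (h2 : x ⬝ᵥ x ≤ 2) :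
    ∃ a, (x a = 1 ∨ x a = -1) ∧
      (x - Pi.single a (x a)) ⬝ᵥ (x - Pi.single a (x a)) = x ⬝ᵥ x - 1 := by
  obtain ⟨a, ha⟩ := Function.ne_iff.1 h0
  have hsq : x a * x a ≤ x ⬝ᵥ x :=
    Finset.single_le_sum (f := fun b => x b * x b) (fun b _ => mul_self_nonneg (x b))
      (Finset.mem_univ a)
  have hxa : x a = 1 ∨ x a = -1 := by
    have hle : x a ≤ 1 := by nlinarith
    have hge : -1 ≤ x a := by nlinarith
    rw [Pi.zero_apply] at ha
    omega
  refine ⟨a, hxa, ?_⟩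
  rw [sub_dotProduct, dotProduct_sub, dotProduct_sub, single_dotProduct, single_dotProduct,
    dotProduct_single, Pi.single_eq_same]
  rcases hxa with h | h <;> rw [h] <;> ring

theorem exists_eq_single_of_dotProduct_self_eq_one [DecidableEq ι] {x : ι → ℤ} (h : x ⬝ᵥ x = 1) :
    ∃ a, (x a = 1 ∨ x a = -1) ∧ x = Pi.single a (x a) := by
  have h0 : x ≠ 0 := by
    rintro rfl
    simp at h
  obtain ⟨a, ha, hsub⟩ := exists_dotProduct_sub_single h0 (by omega)
  rw [h, sub_self, dotProduct_self_eq_zero, sub_eq_zero] at hsub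
  exact ⟨a, ha, hsub⟩

theorem exists_eq_single_add_single_of_dotProduct_self_eq_two [DecidableEq ι] {x : ι → ℤ}
    (h : x ⬝ᵥ x = 2) : ∃ a b, a ≠ b ∧ (x a = 1 ∨ x a = -1) ∧ (x b = 1 ∨ x b = -1) ∧
      x = Pi.single a (x a) + Pi.single b (x b) := by
  have h0 : x ≠ 0 := by
    rintro rfl
    simp at h
  obtain ⟨a, ha, hsub⟩ := exists_dotProduct_sub_single h0 h.le
  obtain ⟨b, hb, hx⟩ := exists_eq_single_of_dotProduct_self_eq_one (hsub.trans (by omega))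
  have hab : b ≠ a := by
    rintro rfl
    simp at hb
  rw [Pi.sub_apply, Pi.single_eq_of_ne hab, sub_zero] at hb hx
  exact ⟨a, b, hab.symm, ha, hb, sub_eq_iff_eq_add'.1 hx⟩

theorem intCastVec_dotProduct (f g : ι → ℤ) :
    intCastVec ι f ⬝ᵥ intCastVec ι g = ((f ⬝ᵥ g : ℤ) : ℚ) := by
  simp only [dotProduct, Int.cast_sum, Int.cast_mul]
  rfl

theorem exists_int_dotProduct {x y : ι → ℚ} (hx : x ∈ integralVectors ι)
    (hy : y ∈ integralVectors ι) : ∃ z : ℤ, (z : ℚ) = x ⬝ᵥ y := by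
  obtain ⟨f, rfl⟩ := hx
  obtain ⟨g, rfl⟩ := hy
  exact ⟨f ⬝ᵥ g, (intCastVec_dotProduct f g).symm⟩

/-- The roots of type `B` (`t = 1`) or `C` (`t = 2`): the integral vectors of square length `2` and
the multiples `t z` of the integral vectors `z` of square length `1`. -/
def chainRootSet (t : ℚ) : Set (ι → ℚ) :=
  {x | x ∈ integralVectors ι ∧ x ⬝ᵥ x = 2} ∪ {x | ∃ z ∈ integralVectors ι, z ⬝ᵥ z = 1 ∧ t • z = x}

/-- The standard scalar product on `ℚ^ι`. -/
abbrev dotForm (ι : Type*) [Fintype ι] : LinearMap.BilinForm ℚ (ι → ℚ) := dotProductBilin ℚ ℚ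

theorem formCoroot_dotForm_of_dotProduct_self_eq_two {x : ι → ℚ} (h : x ⬝ᵥ x = 2) (y : ι → ℚ) :
    formCoroot (dotForm ι) x y = x ⬝ᵥ y := by
  rw [formCoroot_apply, dotProductBilin_apply_apply, dotProductBilin_apply_apply, h,
    div_self two_ne_zero, one_mul]

theorem formCoroot_dotForm_smul {t : ℚ} (ht : t ≠ 0) {z : ι → ℚ} (h : z ⬝ᵥ z = 1) (y : ι → ℚ) :
    formCoroot (dotForm ι) (t • z) y = 2 / t * (z ⬝ᵥ y) := by
  rw [formCoroot_apply, dotProductBilin_apply_apply, dotProductBilin_apply_apply, smul_dotProduct,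
    smul_dotProduct, dotProduct_smul, h]
  simp only [smul_eq_mul]
  field_simp

theorem isSymm_dotForm : (dotForm ι).IsSymm := ⟨dotProduct_comm⟩

variable {t : ℚ} {x : ι → ℚ}

theorem dotProduct_self_of_mem_chainRootSet (hx : x ∈ chainRootSet t) :
    x ⬝ᵥ x = 2 ∨ x ⬝ᵥ x = t * t := by
  rcases hx with ⟨-, hx⟩ | ⟨z, -, hz, rfl⟩
  · exact Or.inl hx
  · right
    rw [smul_dotProduct, dotProduct_smul, hz, smul_eq_mul, smul_eq_mul, mul_one]

theorem dotProduct_self_ne_zero_of_mem_chainRootSet (ht : t ≠ 0) (hx : x ∈ chainRootSet t) :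
    x ⬝ᵥ x ≠ 0 := by
  rcases dotProduct_self_of_mem_chainRootSet hx with h | h <;> rw [h]
  · exact two_ne_zero
  · exact mul_ne_zero ht ht

theorem formCoroot_smul_mem_integralVectors (ht : t ≠ 0) (hx : x ∈ chainRootSet t) {y : ι → ℚ}
    (hy : y ∈ integralVectors ι) : formCoroot (dotForm ι) x y • x ∈ integralVectors ι := by
  rcases hx with ⟨hx, hxx⟩ | ⟨z, hz, hzz, rfl⟩
  · obtain ⟨m, hm⟩ := exists_int_dotProduct hx hy
    rw [formCoroot_dotForm_of_dotProduct_self_eq_two hxx, ← hm, Int.cast_smul_eq_zsmul]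
    exact zsmul_mem hx m
  · obtain ⟨m, hm⟩ := exists_int_dotProduct hz hy
    have h : formCoroot (dotForm ι) (t • z) y • t • z = (2 * m) • z := by
      rw [formCoroot_dotForm_smul ht hzz, ← hm, smul_smul, ← Int.cast_smul_eq_zsmul ℚ]
      congr 1
      push_cast
      field_simp
    exact h ▸ zsmul_mem hz _

theorem reflection_mem_chainRootSet (ht : t ≠ 0) (hx : x ∈ chainRootSet t) {y : ι → ℚ}
    (hy : y ∈ chainRootSet t) : y - formCoroot (dotForm ι) x y • x ∈ chainRootSet t := by
  have hxx := dotProduct_self_ne_zero_of_mem_chainRootSet ht hx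
  have hL {z : ι → ℚ} (hz : z ∈ integralVectors ι) :
      z - formCoroot (dotForm ι) x z • x ∈ integralVectors ι :=
    sub_mem hz (formCoroot_smul_mem_integralVectors ht hx hz)
  rcases hy with ⟨hy, hyy⟩ | ⟨z, hz, hzz, rfl⟩
  · exact Or.inl ⟨hL hy, (form_reflection isSymm_dotForm hxx y).trans hyy⟩
  · refine Or.inr ⟨_, hL hz, (form_reflection isSymm_dotForm hxx z).trans hzz, ?_⟩
    simp only [map_smul, smul_sub, smul_assoc]

theorem mem_integralVectors_of_mem_chainRootSet {m : ℤ} (hx : x ∈ chainRootSet (m : ℚ)) :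
    x ∈ integralVectors ι := by
  rcases hx with ⟨hx, -⟩ | ⟨z, hz, -, rfl⟩
  · exact hx
  · rw [Int.cast_smul_eq_zsmul]
    exact zsmul_mem hz m

theorem exists_int_eq_formCoroot {m m' : ℤ} (hm : m * m' = 2) (hx : x ∈ chainRootSet (m : ℚ))
    {y : ι → ℚ} (hy : y ∈ chainRootSet (m : ℚ)) :
    ∃ z : ℤ, (z : ℚ) = formCoroot (dotForm ι) y x := by
  have hx := mem_integralVectors_of_mem_chainRootSet hx
  have hm0 : (m : ℚ) ≠ 0 := Int.cast_ne_zero.2 (left_ne_zero_of_mul (hm.trans_ne two_ne_zero))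
  rcases hy with ⟨hy, hyy⟩ | ⟨z, hz, hzz, rfl⟩
  · rw [formCoroot_dotForm_of_dotProduct_self_eq_two hyy]
    exact exists_int_dotProduct hy hx
  · obtain ⟨r, hr⟩ := exists_int_dotProduct hz hx
    refine ⟨m' * r, ?_⟩
    rw [formCoroot_dotForm_smul hm0 hzz, ← hr, Int.cast_mul, ← Int.cast_two, ← hm, Int.cast_mul,
      mul_div_cancel_left₀ _ hm0]

theorem neg_mem_chainRootSet (hx : x ∈ chainRootSet t) : -x ∈ chainRootSet t := by
  rcases hx with ⟨hx, h⟩ | ⟨z, hz, h, rfl⟩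
  · exact Or.inl ⟨neg_mem hx, (neg_dotProduct_neg x x).trans h⟩
  · exact Or.inr ⟨-z, neg_mem hz, (neg_dotProduct_neg z z).trans h, smul_neg t z⟩

theorem eq_one_or_neg_one_of_smul_mem_chainRootSet (ht : t ≠ 0) (hx : x ∈ chainRootSet t) {c : ℚ}
    (hc : c • x ∈ chainRootSet t) : c = 1 ∨ c = -1 := by
  have two_ne (d : ℚ) : d * d ≠ 2 := fun hd =>
    Nat.prime_two.prime.irreducible.not_isSquare (Rat.isSquare_natCast_iff.1 ⟨d, hd.symm⟩)
  refine mul_self_eq_one_iff.1 ?_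
  have hcx := dotProduct_self_of_mem_chainRootSet hc
  rw [smul_dotProduct, dotProduct_smul, smul_eq_mul, smul_eq_mul] at hcx
  rcases dotProduct_self_of_mem_chainRootSet hx with h | h <;> rw [h] at hcx <;>
    rcases hcx with hcx | hcx
  · linarith
  · refine absurd ?_ (two_ne (2 * c / t))
    field_simp
    linarith
  · exact absurd (by linarith) (two_ne (c * t))
  · refine mul_right_cancel₀ (mul_ne_zero ht ht) ?_
    linarith

end ChainRoots

section PositiveChainRoots

open Matrix

variable {ι : Type*} [LinearOrder ι] {t : ℚ}

/-- The positive roots `e_a - e_b` and `e_a + e_b` for `a < b`, and `t e_a`. -/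
inductive IsChainRoot (t : ℚ) : (ι → ℚ) → Prop
  | sub (a b : ι) (h : a < b) : IsChainRoot t (Pi.single a 1 - Pi.single b 1)
  | add (a b : ι) (h : a < b) : IsChainRoot t (Pi.single a 1 + Pi.single b 1)
  | smul (a : ι) : IsChainRoot t (t • Pi.single a 1)

theorem finite_setOf_isChainRoot [Finite ι] : {x : ι → ℚ | IsChainRoot t x}.Finite := by
  refine ((Set.finite_range fun p : ι × ι => (Pi.single p.1 1 - Pi.single p.2 1 : ι → ℚ)).union
    ((Set.finite_range fun p : ι × ι => (Pi.single p.1 1 + Pi.single p.2 1 : ι → ℚ)).union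
      (Set.finite_range fun a : ι => t • (Pi.single a 1 : ι → ℚ)))).subset ?_
  rintro _ (⟨a, b, -⟩ | ⟨a, b, -⟩ | a)
  · exact Or.inl ⟨(a, b), rfl⟩
  · exact Or.inr (Or.inl ⟨(a, b), rfl⟩)
  · exact Or.inr (Or.inr ⟨a, rfl⟩)

theorem isChainRoot_or_neg_single_add_single {a b : ι} (hab : a ≠ b) {u v : ℚ}
    (hu : u = 1 ∨ u = -1) (hv : v = 1 ∨ v = -1) :
    IsChainRoot t (Pi.single a u + Pi.single b v : ι → ℚ) ∨
      IsChainRoot t (-(Pi.single a u + Pi.single b v : ι → ℚ)) := by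
  wlog hlt : a < b generalizing a b u v
  · rw [add_comm]
    exact this hab.symm hv hu (hab.lt_or_gt.resolve_left hlt)
  have hadd : IsChainRoot t (Pi.single a 1 + Pi.single b 1) := .add a b hlt
  have hsub : IsChainRoot t (Pi.single a 1 - Pi.single b 1) := .sub a b hlt
  rcases hu with rfl | rfl <;> rcases hv with rfl | rfl
  · exact Or.inl hadd
  · exact Or.inl (by rwa [Pi.single_neg, ← sub_eq_add_neg])
  · exact Or.inr (by rwa [Pi.single_neg, neg_add, neg_neg, ← sub_eq_add_neg])
  · exact Or.inr (by rwa [Pi.single_neg, Pi.single_neg, neg_add, neg_neg, neg_neg])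

variable [Fintype ι]

theorem single_dotProduct_single_of_ne {a b : ι} (h : a ≠ b) :
    (Pi.single a 1 : ι → ℚ) ⬝ᵥ Pi.single b 1 = 0 := by
  rw [single_one_dotProduct, Pi.single_eq_of_ne h]

theorem single_dotProduct_single_self (a : ι) :
    (Pi.single a 1 : ι → ℚ) ⬝ᵥ Pi.single a 1 = 1 := by
  rw [single_one_dotProduct, Pi.single_eq_same]

theorem single_sub_single_dotProduct_self {a b : ι} (h : a ≠ b) :
    (Pi.single a 1 - Pi.single b 1 : ι → ℚ) ⬝ᵥ (Pi.single a 1 - Pi.single b 1) = 2 := by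
  rw [sub_dotProduct, dotProduct_sub, dotProduct_sub, single_dotProduct_single_self,
    single_dotProduct_single_self, single_dotProduct_single_of_ne h,
    single_dotProduct_single_of_ne h.symm]
  norm_num

theorem single_add_single_dotProduct_self {a b : ι} (h : a ≠ b) :
    (Pi.single a 1 + Pi.single b 1 : ι → ℚ) ⬝ᵥ (Pi.single a 1 + Pi.single b 1) = 2 := by
  rw [add_dotProduct, dotProduct_add, dotProduct_add, single_dotProduct_single_self,
    single_dotProduct_single_self, single_dotProduct_single_of_ne h,
    single_dotProduct_single_of_ne h.symm]
  norm_num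

theorem IsChainRoot.mem_chainRootSet {x : ι → ℚ} (hx : IsChainRoot t x) : x ∈ chainRootSet t := by
  rcases hx with ⟨a, b, h⟩ | ⟨a, b, h⟩ | a
  · exact Or.inl ⟨sub_mem (single_mem_integralVectors a) (single_mem_integralVectors b),
      single_sub_single_dotProduct_self h.ne⟩
  · exact Or.inl ⟨add_mem (single_mem_integralVectors a) (single_mem_integralVectors b),
      single_add_single_dotProduct_self h.ne⟩
  · exact Or.inr ⟨_, single_mem_integralVectors a, single_dotProduct_single_self a, rfl⟩

theorem mem_chainRootSet_iff (x : ι → ℚ) :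
    x ∈ chainRootSet t ↔ IsChainRoot t x ∨ IsChainRoot t (-x) := by
  refine ⟨?_, fun h => h.elim IsChainRoot.mem_chainRootSet fun h =>
    neg_neg x ▸ neg_mem_chainRootSet h.mem_chainRootSet⟩
  rintro (⟨⟨f, rfl⟩, hf⟩ | ⟨_, ⟨f, rfl⟩, hf, rfl⟩)
  · rw [intCastVec_dotProduct] at hf
    obtain ⟨a, b, hab, ha, hb, hfab⟩ :=
      exists_eq_single_add_single_of_dotProduct_self_eq_two (Int.cast_injective hf)
    rw [hfab, map_add, intCastVec_single, intCastVec_single]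
    exact isChainRoot_or_neg_single_add_single hab (by exact_mod_cast ha) (by exact_mod_cast hb)
  · rw [intCastVec_dotProduct] at hf
    obtain ⟨a, ha, hfa⟩ := exists_eq_single_of_dotProduct_self_eq_one (Int.cast_injective hf)
    rw [hfa, intCastVec_single]
    rcases ha with ha | ha <;> rw [ha]
    · exact Or.inl (Int.cast_one (R := ℚ) ▸ .smul a)
    · refine Or.inr ?_
      rw [Int.cast_neg, Int.cast_one, Pi.single_neg, smul_neg, neg_neg]
      exact .smul a

theorem finite_chainRootSet : (chainRootSet t : Set (ι → ℚ)).Finite := by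
  rw [Set.ext mem_chainRootSet_iff]
  exact finite_setOf_isChainRoot.union (finite_setOf_isChainRoot.preimage neg_injective.injOn)

theorem span_chainRootSet (ht : t ≠ 0) : Submodule.span ℚ (chainRootSet t : Set (ι → ℚ)) = ⊤ := by
  rw [eq_top_iff, ← (Pi.basisFun ℚ ι).span_eq, Submodule.span_le]
  rintro _ ⟨a, rfl⟩
  have h := Submodule.smul_mem _ t⁻¹
    (Submodule.subset_span (R := ℚ) (IsChainRoot.smul (t := t) a).mem_chainRootSet)
  rwa [inv_smul_smul₀ ht, ← Pi.basisFun_apply] at h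

theorem isRootSet_chainRootSet {m m' : ℤ} (hm : m * m' = 2) :
    IsRootSet (dotForm ι) (chainRootSet (m : ℚ)) :=
  have hm0 : (m : ℚ) ≠ 0 := Int.cast_ne_zero.2 (left_ne_zero_of_mul (hm.trans_ne two_ne_zero))
  { isSymm := isSymm_dotForm
    anisotropic := fun _ => dotProduct_self_eq_zero.1
    finite := finite_chainRootSet
    span_eq_top := span_chainRootSet hm0
    zero_notMem := fun h =>
      dotProduct_self_ne_zero_of_mem_chainRootSet hm0 h (dotProduct_zero 0)
    reflection_mem := fun _ hx _ hy => reflection_mem_chainRootSet hm0 hx hy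
    exists_int := fun _ hx _ hy => exists_int_eq_formCoroot hm hx hy
    eq_one_or_neg_one := fun _ hx _ hc => eq_one_or_neg_one_of_smul_mem_chainRootSet hm0 hx hc }

end PositiveChainRoots

section SimpleChainRoots

open Matrix

variable {n : ℕ} {t : ℚ}

/-- The simple roots `e_i - e_{i+1}` and `t e_{n-1}`. -/
def chainSimple (t : ℚ) (i : Fin n) : Fin n → ℚ :=
  if h : (i : ℕ) + 1 < n then Pi.single i 1 - Pi.single ⟨i + 1, h⟩ 1 else t • Pi.single i 1

theorem isChainRoot_chainSimple (i : Fin n) : IsChainRoot t (chainSimple t i) := by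
  unfold chainSimple
  split_ifs with h
  · exact .sub _ _ (Fin.lt_def.2 (Nat.lt_succ_self _))
  · exact .smul i

theorem single_sub_single_mem_closure {a b : Fin n} (hab : a ≤ b) :
    (Pi.single a 1 - Pi.single b 1 : Fin n → ℚ) ∈
      AddSubmonoid.closure (Set.range (chainSimple (n := n) t)) := by
  obtain ⟨b, hb⟩ := b
  induction b with
  | zero =>
    obtain rfl : a = ⟨0, hb⟩ := Fin.ext (Nat.le_zero.1 hab)
    rw [sub_self]
    exact zero_mem _
  | succ b ih =>
    rcases hab.lt_or_eq with h | rfl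
    · have hprev := ih (by omega) (Fin.le_def.2 (Nat.lt_succ_iff.1 (Fin.lt_def.1 h)))
      have hstep : chainSimple t (⟨b, by omega⟩ : Fin n) ∈
          AddSubmonoid.closure (Set.range (chainSimple (n := n) t)) :=
        AddSubmonoid.subset_closure ⟨_, rfl⟩
      rw [chainSimple, dif_pos hb] at hstep
      rw [← sub_add_sub_cancel]
      exact add_mem hprev hstep
    · rw [sub_self]
      exact zero_mem _

theorem smul_single_last_mem_closure {c : ℕ} :
    (t • Pi.single (Fin.last c) 1 : Fin (c + 1) → ℚ) ∈
      AddSubmonoid.closure (Set.range (chainSimple (n := c + 1) t)) :=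
  AddSubmonoid.subset_closure ⟨Fin.last c, dif_neg (lt_irrefl _)⟩

/-- `m' = 2 / m` copies of `m e_c` make up the `2 e_c` in
`e_a + e_b = (e_a - e_c) + (e_b - e_c) + 2 e_c`. -/
theorem single_add_single_mem_closure {c m m' : ℕ} (hm : m * m' = 2) (a b : Fin (c + 1)) :
    (Pi.single a 1 + Pi.single b 1 : Fin (c + 1) → ℚ) ∈
      AddSubmonoid.closure (Set.range (chainSimple (n := c + 1) (m : ℚ))) := by
  have hlast := nsmul_mem (smul_single_last_mem_closure (t := m) (c := c)) m'
  rw [← Nat.cast_smul_eq_nsmul ℚ, smul_smul, ← Nat.cast_mul, mul_comm, hm] at hlast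
  convert add_mem (add_mem (single_sub_single_mem_closure (Fin.le_last a))
    (single_sub_single_mem_closure (Fin.le_last b))) hlast using 1
  module

theorem IsChainRoot.mem_closure {c m m' : ℕ} (hm : m * m' = 2) {x : Fin (c + 1) → ℚ}
    (hx : IsChainRoot (m : ℚ) x) :
    x ∈ AddSubmonoid.closure (Set.range (chainSimple (n := c + 1) (m : ℚ))) := by
  rcases hx with ⟨a, b, h⟩ | ⟨a, b, -⟩ | a
  · exact single_sub_single_mem_closure h.le
  · exact single_add_single_mem_closure hm a b
  · convert add_mem (nsmul_mem (single_sub_single_mem_closure (Fin.le_last a)) m)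
      smul_single_last_mem_closure using 1
    module

theorem linearIndependent_chainSimple {c m m' : ℕ} (hm : m * m' = 2) :
    LinearIndependent ℚ (chainSimple (n := c + 1) (m : ℚ)) := by
  have hm0 : (m : ℚ) ≠ 0 := Nat.cast_ne_zero.2 (left_ne_zero_of_mul (hm.trans_ne two_ne_zero))
  refine linearIndependent_of_top_le_span_of_card_eq_finrank ?_ (by simp)
  have hle : AddSubmonoid.closure (Set.range (chainSimple (n := c + 1) (m : ℚ))) ≤
      (Submodule.span ℚ (Set.range (chainSimple (n := c + 1) (m : ℚ)))).toAddSubmonoid :=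
    AddSubmonoid.closure_le.2 Submodule.subset_span
  rw [← span_chainRootSet hm0, Submodule.span_le]
  intro x hx
  rcases (mem_chainRootSet_iff x).1 hx with hx | hx
  · exact hle (hx.mem_closure hm)
  · exact (Submodule.neg_mem_iff _).1 (hle (hx.mem_closure hm))

theorem isSimpleSystem_chainSimple {c m m' : ℕ} (hm : m * m' = 2) :
    IsSimpleSystem ℚ (chainRootSet (m : ℚ)) {x | IsChainRoot (m : ℚ) x}
      (chainSimple (n := c + 1) (m : ℚ)) where
  linearIndependent := linearIndependent_chainSimple hm
  mem := isChainRoot_chainSimple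
  mem_iff := mem_chainRootSet_iff
  subset_closure _ hx := hx.mem_closure hm

theorem formCoroot_chainSimple (ht : t ≠ 0) (i : Fin n) (y : Fin n → ℚ) :
    formCoroot (dotForm (Fin n)) (chainSimple t i) y = chainSimple (2 / t) i ⬝ᵥ y := by
  unfold chainSimple
  split_ifs with h
  · exact formCoroot_dotForm_of_dotProduct_self_eq_two
      (single_sub_single_dotProduct_self (Fin.ne_of_lt (Fin.lt_def.2 (Nat.lt_succ_self _)))) y
  · rw [formCoroot_dotForm_smul ht (single_dotProduct_single_self i), smul_dotProduct, smul_eq_mul]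

theorem cartanMatrix_B_eq_dotProduct (i j : Fin n) :
    (CartanMatrix.B n i j : ℚ) = chainSimple 2 j ⬝ᵥ chainSimple 1 i := by
  have hi := i.2
  have hj := j.2
  unfold chainSimple CartanMatrix.B
  split_ifs with h1 h2 h2 <;>
    simp only [sub_dotProduct, dotProduct_sub, smul_dotProduct, dotProduct_smul,
      single_dotProduct, Pi.single_apply, Fin.ext_iff, of_apply, smul_eq_mul, one_mul] <;>
    split_ifs <;> first | omega | norm_num

theorem cartanMatrix_B_eq_formCoroot (i j : Fin n) : (CartanMatrix.B n i j : ℚ) =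
    formCoroot (dotForm (Fin n)) (chainSimple 1 j) (chainSimple 1 i) := by
  rw [formCoroot_chainSimple one_ne_zero, div_one, cartanMatrix_B_eq_dotProduct]

theorem cartanMatrix_C_eq_formCoroot (i j : Fin n) : (CartanMatrix.C n i j : ℚ) =
    formCoroot (dotForm (Fin n)) (chainSimple 2 j) (chainSimple 2 i) := by
  rw [formCoroot_chainSimple two_ne_zero, div_self two_ne_zero, ← CartanMatrix.B_transpose,
    transpose_apply, cartanMatrix_B_eq_dotProduct, dotProduct_comm]

end SimpleChainRoots

theorem isPositiveRootsOfType_isChainRoot {c m m' : ℕ} (hm : m * m' = 2)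
    {A : Matrix (Fin (c + 1)) (Fin (c + 1)) ℤ} (hA : ∀ i j, (A i j : ℚ) =
      formCoroot (dotForm (Fin (c + 1))) (chainSimple (m : ℚ) j) (chainSimple (m : ℚ) i))
    {X : Type} {Φ : (Fin (c + 1) → ℚ) →ₗ[ℚ] X → ℚ} (hΦ : Function.Injective Φ) :
    IsPositiveRootsOfType (Φ '' {x | IsChainRoot (m : ℚ) x}) A
      fun i => Φ (chainSimple (m : ℚ) i) :=
  have hR : IsRootSet (dotForm (Fin (c + 1))) (chainRootSet (m : ℚ)) :=
    Int.cast_natCast (R := ℚ) m ▸ isRootSet_chainRootSet (m' := m') (by exact_mod_cast hm)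
  isPositiveRootsOfType_of_isRootSet hR (isSimpleSystem_chainSimple hm) hA Φ hΦ

/-! ### Dimension vectors as roots -/

section IntervalEmbedding

variable {X : Type} {pos : X → ℕ} {c : ℕ}

/-- The embedding of the Euclidean space into the space of dimension vectors which sends the vector
`e_a` to the indicator of the symmetric interval `[a, 2c - a]`. -/
noncomputable def intervalEmbedding (pos : X → ℕ) (c : ℕ) : (Fin (c + 1) → ℚ) →ₗ[ℚ] X → ℚ :=
  Fintype.linearCombination ℚ fun a => (posInterval pos a (2 * c - a)).indicator 1

theorem intervalEmbedding_apply (x : Fin (c + 1) → ℚ) (i : X) :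
    intervalEmbedding pos c x i =
      ∑ a : Fin (c + 1), if a ≤ pos i ∧ pos i + a ≤ 2 * c then x a else 0 := by
  classical
  rw [intervalEmbedding, Fintype.linearCombination_apply, Finset.sum_apply]
  refine Finset.sum_congr rfl fun a _ => ?_
  rw [Pi.smul_apply, Set.indicator_apply, Pi.one_apply, smul_eq_mul, mul_ite, mul_one, mul_zero]
  have := a.2
  exact if_congr (and_congr_right fun _ => by omega) rfl rfl

theorem intervalEmbedding_single (a : Fin (c + 1)) (i : X) :
    intervalEmbedding pos c (Pi.single a 1) i =
      if a ≤ pos i ∧ pos i + a ≤ 2 * c then 1 else 0 := by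
  rw [intervalEmbedding_apply, Finset.sum_eq_single_of_mem a (Finset.mem_univ a),
    Pi.single_eq_same]
  intro b _ hb
  rw [Pi.single_eq_of_ne hb, ite_self]

theorem intervalEmbedding_injective (h : ∀ p ≤ c, ∃ i, pos i = p) :
    Function.Injective (intervalEmbedding pos c) := by
  rw [← LinearMap.ker_eq_bot, LinearMap.ker_eq_bot']
  intro x hx
  funext ⟨p, hp⟩
  induction p using Nat.strong_induction_on with
  | _ p ih =>
    obtain ⟨i, rfl⟩ := h p (Nat.le_of_lt_succ hp)
    have hxi := congrFun hx i
    rwa [intervalEmbedding_apply, Finset.sum_eq_single_of_mem ⟨pos i, hp⟩ (Finset.mem_univ _),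
      if_pos ⟨le_rfl, by dsimp only; omega⟩] at hxi
    intro b _ hb
    rcases lt_trichotomy (b : ℕ) (pos i) with hlt | heq | hgt
    · rw [ih b hlt b.2, Pi.zero_apply, ite_self]
    · exact absurd (Fin.ext heq) hb
    · exact if_neg fun h => hgt.not_ge h.1

end IntervalEmbedding

namespace SignedQuiver

/-- The coefficient `t` of the root `t e_a` attached to the symmetric interval starting at `a`. -/
def rootScale (s : SignType) : ℕ := if s = 1 then 1 else 2

namespace IsSymmetricChain

variable {Q : SignedQuiver} {c : ℕ} {pos : Q.Double → ℕ} {s : SignType}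

theorem rootDim_of_add_eq (hQ : Q.IsSymmetricChain c pos s) {p q : ℕ} (hpq : p + q = 2 * c)
    (i : Q.Double) : (rootDim s (posInterval pos p q) i : ℚ) =
      rootScale s * if p ≤ pos i ∧ pos i ≤ q then 1 else 0 := by
  classical
  have hself : Double.star ⁻¹' posInterval pos p q = posInterval pos p q := by
    rw [hQ.star_preimage_posInterval (by omega) (by omega)]
    congr 1 <;> omega
  have hi : i ∈ posInterval pos p q ↔ p ≤ pos i ∧ pos i ≤ q := Iff.rfl
  simp only [rootDim, rootScale, hself, and_true, ← hi]
  split_ifs <;> simp_all [one_add_one_eq_two]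

theorem rootDim_of_add_ne (hQ : Q.IsSymmetricChain c pos s) {p q : ℕ} (hpq : p ≤ q)
    (hq : q ≤ 2 * c) (h : p + q ≠ 2 * c) (i : Q.Double) :
    (rootDim s (posInterval pos p q) i : ℚ) = (if p ≤ pos i ∧ pos i ≤ q then 1 else 0) +
      if 2 * c ≤ pos i + q ∧ pos i + p ≤ 2 * c then 1 else 0 := by
  classical
  have hself : Double.star ⁻¹' posInterval pos p q ≠ posInterval pos p q :=
    (hQ.star_preimage_posInterval_eq_self hpq hq).not.2 h
  rw [rootDim, if_neg fun h => hself h.2, Pi.add_apply, Nat.cast_add,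
    hQ.star_preimage_posInterval (hpq.trans hq) hq, Set.indicator_apply, Set.indicator_apply,
    Pi.one_apply, Nat.cast_ite, Nat.cast_ite, Nat.cast_one, Nat.cast_zero]
  exact congrArg₂ (· + ·) (if_congr Iff.rfl rfl rfl)
    (if_congr (and_congr (by omega) (by omega)) rfl rfl)

theorem intervalEmbedding_sub (hQ : Q.IsSymmetricChain c pos s) {a b : Fin (c + 1)} (h : a < b)
    (i : Q.Double) : intervalEmbedding pos c (Pi.single a 1 - Pi.single b 1) i =
      rootDim s (posInterval pos a (b - 1)) i := by
  have := Fin.lt_def.1 h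
  rw [map_sub, Pi.sub_apply, intervalEmbedding_single, intervalEmbedding_single,
    hQ.rootDim_of_add_ne (by omega) (by omega) (by omega)]
  split_ifs <;> first | omega | norm_num

theorem intervalEmbedding_add (hQ : Q.IsSymmetricChain c pos s) {a b : Fin (c + 1)} (h : a < b)
    (i : Q.Double) : intervalEmbedding pos c (Pi.single a 1 + Pi.single b 1) i =
      rootDim s (posInterval pos a (2 * c - b)) i := by
  have := Fin.lt_def.1 h
  rw [map_add, Pi.add_apply, intervalEmbedding_single, intervalEmbedding_single,
    hQ.rootDim_of_add_ne (by omega) (by omega) (by omega)]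
  split_ifs <;> first | omega | norm_num

theorem intervalEmbedding_smul (hQ : Q.IsSymmetricChain c pos s) (a : Fin (c + 1))
    (i : Q.Double) : intervalEmbedding pos c ((rootScale s : ℚ) • Pi.single a 1) i =
      rootDim s (posInterval pos a (2 * c - a)) i := by
  rw [map_smul, Pi.smul_apply, intervalEmbedding_single, hQ.rootDim_of_add_eq (by omega),
    smul_eq_mul]
  congr 1
  exact if_congr (and_congr_right fun _ => by omega) rfl rfl

theorem exists_isChainRoot (hQ : Q.IsSymmetricChain c pos s) {p q : ℕ} (hpq : p ≤ q)
    (hq : q ≤ 2 * c) : ∃ x : Fin (c + 1) → ℚ, IsChainRoot (rootScale s : ℚ) x ∧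
      ∀ i, intervalEmbedding pos c x i = rootDim s (posInterval pos p q) i := by
  wlog h : p + q ≤ 2 * c generalizing p q
  · obtain ⟨x, hx, hxi⟩ := this (p := 2 * c - q) (q := 2 * c - p) (by omega) (by omega) (by omega)
    rw [← hQ.star_preimage_posInterval (hpq.trans hq) hq, rootDim_star_preimage] at hxi
    exact ⟨x, hx, hxi⟩
  rcases h.eq_or_lt with h | h
  · obtain rfl : q = 2 * c - p := by omega
    exact ⟨_, .smul ⟨p, by omega⟩, hQ.intervalEmbedding_smul _⟩
  rcases lt_or_ge q c with hqc | hqc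
  · have hlt : (⟨p, by omega⟩ : Fin (c + 1)) < ⟨q + 1, by omega⟩ :=
      Fin.mk_lt_mk.2 (Nat.lt_succ_of_le hpq)
    exact ⟨_, .sub _ _ hlt, hQ.intervalEmbedding_sub hlt⟩
  · obtain ⟨b, hb, rfl⟩ : ∃ b ≤ c, q = 2 * c - b := ⟨2 * c - q, by omega, by omega⟩
    have hlt : (⟨p, by omega⟩ : Fin (c + 1)) < ⟨b, by omega⟩ := Fin.mk_lt_mk.2 (by omega)
    exact ⟨_, .add _ _ hlt, hQ.intervalEmbedding_add hlt⟩

theorem symDims_eq_image {k : Type u} [Field k] (hk : (2 : k) ≠ 0)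
    (hQ : Q.IsSymmetricChain c pos s) :
    symDims k Q = intervalEmbedding pos c '' {x | IsChainRoot (rootScale s : ℚ) x} := by
  rw [symDims_eq hk hQ]
  ext d
  constructor
  · rintro ⟨p, q, hpq, hq, hd⟩
    obtain ⟨x, hx, hxi⟩ := hQ.exists_isChainRoot hpq hq
    exact ⟨x, hx, funext fun i => (hxi i).trans (hd i).symm⟩
  · rintro ⟨_, ⟨a, b, h⟩ | ⟨a, b, h⟩ | a, rfl⟩
    · have := Fin.lt_def.1 h
      exact ⟨a, b - 1, by omega, by omega, hQ.intervalEmbedding_sub h⟩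
    · have := Fin.lt_def.1 h
      exact ⟨a, 2 * c - b, by omega, by omega, hQ.intervalEmbedding_add h⟩
    · exact ⟨a, 2 * c - a, by omega, by omega, hQ.intervalEmbedding_smul a⟩

end IsSymmetricChain

/-! ### The quivers `B_n` and `C_n` -/

variable {c : ℕ} {o : Fin c → Bool} {s : SignType}

/-- The position of a vertex of `Q̃`, where `Q` is a chain: `i*` is the mirror image of `i`. -/
def chainPos (o : Fin c → Bool) (s : SignType) : (chain (c + 1) o s).Double → ℕ
  | .of i => Fin.val (n := c + 1) i
  | .new i _ => 2 * c - Fin.val (n := c + 1) i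

/-- The position of the left end of an arrow of `Q̃`. -/
def chainArrowPos (o : Fin c → Bool) (s : SignType) : (chain (c + 1) o s).DoubleArrow → ℕ
  | .of a => Fin.val (n := c) a
  | .new a _ => 2 * c - 1 - Fin.val (n := c) a

theorem chain_vsign (i : Fin (c + 1)) :
    (chain (c + 1) o s).vsign i = if (i : ℕ) = c then s else 0 :=
  if_congr Nat.succ_inj rfl rfl

theorem isSingleUnsigned_chain_iff (hs : s ≠ 0) (i : Fin (c + 1)) :
    (chain (c + 1) o s).IsSingleUnsigned i ↔ (i : ℕ) < c := by
  have hi := i.is_le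
  refine (and_iff_right rfl).trans ?_
  rw [chain_vsign, ite_eq_right_iff, hi.lt_iff_ne]
  exact imp_congr_right fun _ => iff_false_intro hs

theorem chainPos_star (hs : s ≠ 0) (i : (chain (c + 1) o s).Double) :
    chainPos o s i.star + chainPos o s i = 2 * c := by
  cases i with
  | of i =>
    have hi : Fin.val (n := c + 1) i ≤ c := Fin.is_le i
    by_cases h : (chain (c + 1) o s).IsSingleUnsigned i
    · simp only [Double.star, h, dite_true, chainPos]
      omega
    · have hc := (isSingleUnsigned_chain_iff hs i).not.1 h
      have htwin : (chain (c + 1) o s).twin i = i := rfl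
      simp only [Double.star, h, dite_false, htwin, chainPos]
      omega
  | new i h =>
    have hi : Fin.val (n := c + 1) i ≤ c := Fin.is_le i
    simp only [Double.star, chainPos]
    omega

theorem chainPos_injective (hs : s ≠ 0) : Function.Injective (chainPos o s) := by
  have ne_new (i j : Fin (c + 1)) (h : (chain (c + 1) o s).IsSingleUnsigned j) :
      chainPos o s (.of i) ≠ chainPos o s (.new j h) := by
    have := (isSingleUnsigned_chain_iff hs j).1 h
    simp only [chainPos]
    omega
  rintro (i | ⟨i, hi⟩) (j | ⟨j, hj⟩) h
  · exact congrArg _ (Fin.ext h)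
  · exact absurd h (ne_new i j hj)
  · exact absurd h.symm (ne_new j i hi)
  · have := (isSingleUnsigned_chain_iff hs i).1 hi
    have := (isSingleUnsigned_chain_iff hs j).1 hj
    obtain rfl : i = j := Fin.ext (by simp only [chainPos] at h; omega)
    rfl

theorem chainArrowPos_injective : Function.Injective (chainArrowPos o s) := by
  have val_lt (a : (chain (c + 1) o s).E) : Fin.val (n := c) a < c := Fin.is_lt a
  rintro (a | ⟨a, _⟩) (b | ⟨b, _⟩) h <;> have ha := val_lt a <;> have hb := val_lt b
  · exact congrArg _ (Fin.ext h)
  · simp only [chainArrowPos] at h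
    omega
  · simp only [chainArrowPos] at h
    omega
  · obtain rfl : a = b := Fin.ext (by simp only [chainArrowPos] at h; omega)
    rfl

theorem exists_chainArrowPos_eq {p : ℕ} (hp : p < 2 * c) :
    ∃ a, chainArrowPos o s a = p := by
  by_cases h : p < c
  · exact ⟨.of (⟨p, h⟩ : Fin c), rfl⟩
  · exact ⟨.new (⟨2 * c - 1 - p, by omega⟩ : Fin c) rfl, Nat.sub_sub_self (by omega)⟩

theorem chainPos_ends_of (a : Fin c) :
    (chainPos o s (.of ((chain (c + 1) o s).tail a)) = a ∧
      chainPos o s (.of ((chain (c + 1) o s).head a)) = a + 1) ∨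
    (chainPos o s (.of ((chain (c + 1) o s).head a)) = a ∧
      chainPos o s (.of ((chain (c + 1) o s).tail a)) = a + 1) := by
  simp only [chainPos, chain]
  cases o a
  · exact Or.inr ⟨rfl, rfl⟩
  · exact Or.inl ⟨rfl, rfl⟩

theorem chainPos_ends (hs : s ≠ 0) (a : (chain (c + 1) o s).DoubleArrow) :
    (chainPos o s a.tail = chainArrowPos o s a ∧
      chainPos o s a.head = chainArrowPos o s a + 1) ∨
    (chainPos o s a.head = chainArrowPos o s a ∧
      chainPos o s a.tail = chainArrowPos o s a + 1) := by
  cases a with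
  | of a => exact chainPos_ends_of a
  | new a h =>
    have htail := chainPos_star hs (.of ((chain (c + 1) o s).tail a))
    have hhead := chainPos_star hs (.of ((chain (c + 1) o s).head a))
    have ha : Fin.val (n := c) a < c := Fin.is_lt a
    have hends := chainPos_ends_of (o := o) (s := s) a
    simp only [chainArrowPos, DoubleArrow.tail, DoubleArrow.head]
    omega

theorem isChainQuiver_chain (hs : s ≠ 0) :
    IsChainQuiver (chain (c + 1) o s).Double (2 * c + 1) (chainPos o s) where
  injective := chainPos_injective hs
  lt x := by
    have := chainPos_star hs x
    omega
  surj p hp := by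
    by_cases h : p < c + 1
    · exact ⟨.of (⟨p, h⟩ : Fin (c + 1)), rfl⟩
    · let i : (chain (c + 1) o s).Double := .of (⟨2 * c - p, by omega⟩ : Fin (c + 1))
      have hi : chainPos o s i = 2 * c - p := rfl
      have := chainPos_star hs i
      exact ⟨i.star, by omega⟩
  adj x y φ := by
    obtain ⟨a, rfl, rfl⟩ := φ
    have := chainPos_ends hs a
    omega
  edge x y hxy := by
    have hy := chainPos_star hs y
    obtain ⟨a, ha⟩ := exists_chainArrowPos_eq (o := o) (s := s) (p := chainPos o s x) (by omega)
    have eq_a (b : (chain (c + 1) o s).DoubleArrow)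
        (hb : min (chainPos o s b.tail) (chainPos o s b.head) = chainPos o s x) : b = a := by
      have := chainPos_ends hs b
      exact chainArrowPos_injective (by omega)
    rcases chainPos_ends hs a with ⟨htail, hhead⟩ | ⟨hhead, htail⟩
    · refine Or.inl ⟨⟨a, chainPos_injective hs (by omega), chainPos_injective hs (by omega)⟩,
        ?_, ⟨?_⟩⟩ <;> rintro ⟨b, rfl, rfl⟩ <;> obtain rfl := eq_a b (by omega)
      · rfl
      · omega
    · refine Or.inr ⟨⟨a, chainPos_injective hs (by omega), chainPos_injective hs (by omega)⟩,
        ?_, ⟨?_⟩⟩ <;> rintro ⟨b, rfl, rfl⟩ <;> obtain rfl := eq_a b (by omega)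
      · rfl
      · omega

theorem isSymmetricChain_chain (hs : s ≠ 0) :
    (chain (c + 1) o s).IsSymmetricChain c (chainPos o s) s where
  chain := isChainQuiver_chain hs
  pos_star := chainPos_star hs
  arrow_sign a := by cases a <;> rfl
  sign_of_fixed i hi := by
    have hc := chainPos_star hs i
    rw [hi] at hc
    cases i with
    | of i =>
      simp only [chainPos] at hc
      exact (chain_vsign i).trans (if_pos (by omega))
    | new i h =>
      have := (isSingleUnsigned_chain_iff hs i).1 h
      simp only [chainPos] at hc
      omega

open Classical in
theorem single_chain_apply (hs : s ≠ 0) (i j : (chain (c + 1) o s).Double) (t : ℚ) :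
    (Pi.single i t : (chain (c + 1) o s).Double → ℚ) j =
      if chainPos o s j = chainPos o s i then t else 0 := by
  rw [Pi.single_apply]
  exact if_congr (chainPos_injective hs).eq_iff.symm rfl rfl

open Classical in
theorem simpleVector_chain_of_eq (hs : s ≠ 0) {i : Fin (c + 1)} (hi : (i : ℕ) = c) :
    simpleVector (chain (c + 1) o s) i = Pi.single (.of i) (rootScale s : ℚ) := by
  unfold simpleVector
  rw [chain_vsign, if_pos hi, rootScale]
  rcases s.trichotomy with rfl | rfl | rfl
  · rw [if_neg (by decide), if_pos rfl, if_neg (by decide), Nat.cast_ofNat]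
  · exact absurd rfl hs
  · rw [if_pos rfl, if_pos rfl, Nat.cast_one]

open Classical in
theorem simpleVector_chain_of_lt {i : Fin (c + 1)} (hi : (i : ℕ) < c) :
    simpleVector (chain (c + 1) o s) i = Pi.single (.of i) 1 + Pi.single (Double.of i).star 1 := by
  unfold simpleVector
  rw [chain_vsign, if_neg hi.ne, if_neg (by decide), if_neg (by decide)]

theorem intervalEmbedding_chainSimple (hs : s ≠ 0) (i : Fin (c + 1)) :
    intervalEmbedding (chainPos o s) c (chainSimple (rootScale s : ℚ) i) =
      simpleVector (chain (c + 1) o s) i := by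
  funext j
  have hpos : chainPos o s (.of i) = i := rfl
  have hi := chainPos_star (o := o) hs (.of i)
  rw [chainSimple]
  rcases i.is_le.eq_or_lt with h | h
  · rw [dif_neg (by omega), simpleVector_chain_of_eq hs h, map_smul, Pi.smul_apply,
      intervalEmbedding_single, single_chain_apply hs, smul_eq_mul, mul_ite, mul_one, mul_zero]
    exact if_congr (by omega) rfl rfl
  · rw [dif_pos (by omega), simpleVector_chain_of_lt h, map_sub, Pi.sub_apply, Pi.add_apply,
      intervalEmbedding_single, intervalEmbedding_single, single_chain_apply hs,
      single_chain_apply hs]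
    dsimp only
    split_ifs <;> first | omega | norm_num

theorem isPositiveRootsOfType_symDims_chain {k : Type u} [Field k] (hk : (2 : k) ≠ 0)
    (o : Fin c → Bool) (hs : s ≠ 0) {m' : ℕ} (hm : rootScale s * m' = 2)
    {A : Matrix (Fin (c + 1)) (Fin (c + 1)) ℤ} (hA : ∀ i j, (A i j : ℚ) =
      formCoroot (dotForm (Fin (c + 1))) (chainSimple (rootScale s : ℚ) j)
        (chainSimple (rootScale s : ℚ) i)) :
    IsPositiveRootsOfType (symDims k (chain (c + 1) o s)) A
      (simpleVector (chain (c + 1) o s)) := by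
  have hQ := isSymmetricChain_chain (o := o) hs
  have hΦ : Function.Injective (intervalEmbedding (chainPos o s) c) :=
    intervalEmbedding_injective fun p hp => hQ.chain.surj p (by omega)
  rw [hQ.symDims_eq_image hk, ← funext (intervalEmbedding_chainSimple hs)]
  exact isPositiveRootsOfType_isChainRoot hm hA hΦ

end SignedQuiver

theorem theorem6p3 {k : Type u} [Field k] (hk : (2 : k) ≠ 0) (n : ℕ) (hn : 1 ≤ n)
    (o : Fin (n - 1) → Bool) :
    IsPositiveRootsOfType (SignedQuiver.symDims k (SignedQuiver.typeB n o)) (CartanMatrix.B n)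
        (SignedQuiver.simpleVector (SignedQuiver.typeB n o)) ∧
      IsPositiveRootsOfType (SignedQuiver.symDims k (SignedQuiver.typeC n o)) (CartanMatrix.C n)
        (SignedQuiver.simpleVector (SignedQuiver.typeC n o)) := by
  obtain ⟨c, rfl⟩ := Nat.exists_eq_add_of_le' hn
  have hB : SignedQuiver.rootScale 1 = 1 := if_pos rfl
  have hC : SignedQuiver.rootScale (-1) = 2 := if_neg (by decide)
  constructor
  · refine SignedQuiver.isPositiveRootsOfType_symDims_chain hk o (by decide) (m' := 2) (by rw [hB])
      fun i j => ?_
    rw [hB, Nat.cast_one, cartanMatrix_B_eq_formCoroot]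
  · refine SignedQuiver.isPositiveRootsOfType_symDims_chain hk o (by decide) (m' := 1) (by rw [hC])
      fun i j => ?_
    rw [hC, Nat.cast_ofNat, cartanMatrix_C_eq_formCoroot]
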